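/- Let $0\le r\le n$, write $U=(U_I,U_{II})\in\mathbb R^r\times\mathbb R^{n-r}$, and consider the viscous system of conservation laws $$\partial_t U+f(U)_x=\big(B(U)U_x\big)_x,\quad 0<x<1,\qquad B=\begin{pmatrix}0&0\\0&B_{22}\end{pmatrix},\ B_{22}(U)\in M_{n-r}(\mathbb R),$$ with boundary conditions $U(0)=U_0=(U_{0I},U_{0II})$, $U_{II}(1)=U_{1II}$. Let $f=(f_I,f_{II})$ and $A(U)=df(U)=\begin{pmatrix}A_{11}&A_{12}\\A_{21}&A_{22}\end{pmatrix}$. Assume: - (H0) $f:\mathbb R^n\to\mathbb R^n$ and $B$ are smooth on $\mathbb R^n$. - (H1) $B_{22}(U)+B_{22}(U)^t>0$ for every $U\in\mathbb R^n$. - (H2) the eigenvalues of $A_{11}(U)=(df_I)_I(U)$ are (real and) positive for every $U$. - (H3) there is a smooth map $U\mapsto S(U)=\begin{pmatrix}S_{11}(U)&0\\0&S_{22}(U)\end{pmatrix}$ such that, for every $U$, $S(U)$ is symmetric positive definite, $S(U)A(U)$ is symmetric, and $S_{22}(U)B_{22}(U)+(S_{22}(U)B_{22}(U))^t>0$. -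 There is a global convex entropy: functions $\eta\in C^2(\mathbb R^n;\mathbb R)$ and $q\in C^1(\mathbb R^n;\mathbb R)$ such that everywhere $d^2\eta>0$, $d\eta\,df=dq$, and $d^2\eta\,B+(d^2\eta\,B)^t\ge0$, with the quadratic form of the last matrix vanishing only on $\ker B$. Let $U_0\in\mathbb R^n$ and let $U_{1II}=U_{0II}$ (constant data). Then the following hold. 1. (Global uniqueness.) The steady problem $f(U)_x=(B(U)U_x)_x$ on $0<x<1$, $U(0)=U_0$, $U_{II}(1)=U_{1II}$, has exactly one solution among functions $U$ that are continuous on $[0,1]$ and differentiable on $(0,1)$ and for which $f(U)$ and $B(U)U_x$ are differentiable on $(0,1)$ and the equation holds pointwise there. It is the constant state $U\equiv U_0$. 2. (Nondegeneracy.) For $C\in\mathbb R^{n-r}$ consider the integrated profile problem on $[0,1]$ $$B_{22}(U)U_{II}'=f_{II}(U)-f_{II}(U_0)+B_{22}(U_0)C,\qquad f_I(U)=f_I(U_0),\qquad U(0)=U_0,$$ for continuous $U$ with differentiable $U_{II}$. For each $C$ it has at most one solution on $[0,1]$, and it has one for all $C$ near $C_*=0$, the value of $U_{II}'(0)$ for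 the constant state. The shooting map $\Phi(C)=U_{II}(1)-U_{1II}$, defined for those $C$ for which the solution exists on $[0,1]$, vanishes at $C_*$, and it is differentiable there with invertible (full-rank) differential. 3. (Spectral stability.) Let $\hat U\equiv U_0$ be the steady solution, and let $$LV=\big(B(\hat U)V_x+(dB(\hat U)V)\hat U_x-A(\hat U)V\big)_x$$ be the linearized operator on $L^2((0,1);\mathbb C^n)$, whose domain consists of the $V\in H^1$ with $V(0)=0$, $V_{II}(1)=0$ and $B(\hat U)V_x+(dB(\hat U)V)\hat U_x-A(\hat U)V\in H^1$. Every $\lambda\in\mathbb C$ with $\operatorname{Re}\lambda\ge0$ lies in the resolvent set of $L$: the operator $\lambda-L$ is a bijection from the domain onto $L^2$ with bounded inverse. -/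

import Mathlib

open Set MeasureTheory Topology
open scoped Matrix ContDiff

/-- The state space `ℝⁿ = ℝʳ × ℝᵐ`, `m = n - r`; the coordinates `Sum.inl i` form `U_I`,
the coordinates `Sum.inr j` form `U_II`. -/
abbrev StateVec (r m : ℕ) : Type := Fin r ⊕ Fin m → ℝ

namespace ViscousLaw

variable {r m : ℕ}

/-- The component `U_I ∈ ℝʳ`. -/
def partI (U : StateVec r m) : Fin r → ℝ := fun i => U (Sum.inl i)

/-- The component `U_II ∈ ℝᵐ`. -/
def partII (U : StateVec r m) : Fin m → ℝ := fun j => U (Sum.inr j)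

/-- The viscosity matrix `B(U)`, whose only nonzero block is `B₂₂(U)`. -/
def visc (B₂₂ : StateVec r m → Matrix (Fin m) (Fin m) ℝ) (U : StateVec r m) :
    Matrix (Fin r ⊕ Fin m) (Fin r ⊕ Fin m) ℝ :=
  Matrix.fromBlocks 0 0 0 (B₂₂ U)

/-- The Jacobian matrix `A(U) = df(U)`. -/
noncomputable def jac (f : StateVec r m → StateVec r m) (U : StateVec r m) :
    Matrix (Fin r ⊕ Fin m) (Fin r ⊕ Fin m) ℝ :=
  LinearMap.toMatrix' (fderiv ℝ f U : StateVec r m →ₗ[ℝ] StateVec r m)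

/-- The Hessian matrix `d²η(U)`. -/
noncomputable def hess (η : StateVec r m → ℝ) (U : StateVec r m) :
    Matrix (Fin r ⊕ Fin m) (Fin r ⊕ Fin m) ℝ :=
  Matrix.of fun i j => fderiv ℝ (fderiv ℝ η) U (Pi.single i 1) (Pi.single j 1)

/-! ### Structural assumptions -/

/-- (H0): `f` and `B` are smooth. -/
def H0 (f : StateVec r m → StateVec r m)
    (B₂₂ : StateVec r m → Matrix (Fin m) (Fin m) ℝ) : Prop :=
  ContDiff ℝ ∞ f ∧ ∀ i j, ContDiff ℝ ∞ fun U => B₂₂ U i j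

/-- (H1): `B₂₂(U) + B₂₂(U)ᵗ > 0` for every `U`. -/
def H1 (B₂₂ : StateVec r m → Matrix (Fin m) (Fin m) ℝ) : Prop :=
  ∀ U, (B₂₂ U + (B₂₂ U)ᵀ).PosDef

/-- (H2): all (complex) eigenvalues of `(df_I)_I(U)` are real and positive, for every `U`. -/
def H2 (f : StateVec r m → StateVec r m) : Prop :=
  ∀ U, ∀ z ∈ spectrum ℂ ((jac f U).toBlocks₁₁.map (fun a : ℝ => (a : ℂ))),
    ∃ t : ℝ, 0 < t ∧ z = (t : ℂ)

/-- (H3): existence of a smooth block-diagonal symmetrizer `S(U)`. -/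
def H3 (f : StateVec r m → StateVec r m)
    (B₂₂ : StateVec r m → Matrix (Fin m) (Fin m) ℝ) : Prop :=
  ∃ (S₁₁ : StateVec r m → Matrix (Fin r) (Fin r) ℝ)
    (S₂₂ : StateVec r m → Matrix (Fin m) (Fin m) ℝ),
    (∀ i j, ContDiff ℝ ∞ fun U => S₁₁ U i j) ∧
    (∀ i j, ContDiff ℝ ∞ fun U => S₂₂ U i j) ∧
    ∀ U, (Matrix.fromBlocks (S₁₁ U) 0 0 (S₂₂ U)).PosDef ∧
      (Matrix.fromBlocks (S₁₁ U) 0 0 (S₂₂ U) * jac f U).IsSymm ∧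
      (S₂₂ U * B₂₂ U + (S₂₂ U * B₂₂ U)ᵀ).PosDef

/-- A global convex entropy: a pair `(η, q)` on `ℝⁿ` with `d²η > 0`, `dη df = dq` and
`d²η B + (d²η B)ᵗ ≥ 0`, the quadratic form of the latter vanishing only on `ker B`. -/
def HasConvexEntropy (f : StateVec r m → StateVec r m)
    (B₂₂ : StateVec r m → Matrix (Fin m) (Fin m) ℝ) : Prop :=
  ∃ η q : StateVec r m → ℝ, ContDiff ℝ 2 η ∧ ContDiff ℝ 1 q ∧
    ∀ U, (hess η U).PosDef ∧
      (fderiv ℝ η U).comp (fderiv ℝ f U) = fderiv ℝ q U ∧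
      (hess η U * visc B₂₂ U + (hess η U * visc B₂₂ U)ᵀ).PosSemidef ∧
      ∀ v, v ⬝ᵥ ((hess η U * visc B₂₂ U + (hess η U * visc B₂₂ U)ᵀ) *ᵥ v) = 0 →
        visc B₂₂ U *ᵥ v = 0

/-! ### Steady solutions -/

/-- `U` is a (classical) solution of `f(U)_x = (B(U) U_x)_x` on `0 < x < 1` with boundary
conditions `U(0) = U₀`, `U_II(1) = U₁`. Only the values of `U` on `[0,1]` matter. -/
structure IsSteadySolution (f : StateVec r m → StateVec r m)
    (B₂₂ : StateVec r m → Matrix (Fin m) (Fin m) ℝ)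
    (U₀ : StateVec r m) (U₁ : Fin m → ℝ) (U : ℝ → StateVec r m) : Prop where
  continuousOn : ContinuousOn U (Icc 0 1)
  differentiableOn : DifferentiableOn ℝ U (Ioo 0 1)
  eqn : ∀ x ∈ Ioo (0 : ℝ) 1, ∃ d : StateVec r m,
    HasDerivAt (fun y => f (U y)) d x ∧
    HasDerivAt (fun y => visc B₂₂ (U y) *ᵥ deriv U y) d x
  left : U 0 = U₀
  right : partII (U 1) = U₁

/-! ### The shooting map and nondegeneracy -/

/-- `U` solves on all of `[0,1]` the integrated profile problem
`B₂₂(U) U_II' = f_II(U) - f_II(U₀) + B₂₂(U₀) C`, `f_I(U) = f_I(U₀)`, `U(0) = U₀`. -/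
structure IsShootingSolution (f : StateVec r m → StateVec r m)
    (B₂₂ : StateVec r m → Matrix (Fin m) (Fin m) ℝ)
    (U₀ : StateVec r m) (C : Fin m → ℝ) (U : ℝ → StateVec r m) : Prop where
  continuousOn : ContinuousOn U (Icc 0 1)
  initial : U 0 = U₀
  constraint : ∀ x ∈ Icc (0 : ℝ) 1, partI (f (U x)) = partI (f U₀)
  ode : ∀ x ∈ Icc (0 : ℝ) 1, ∃ d : Fin m → ℝ,
    HasDerivWithinAt (fun y => partII (U y)) d (Icc 0 1) x ∧
    B₂₂ (U x) *ᵥ d = partII (f (U x)) - partII (f U₀) + B₂₂ U₀ *ᵥ C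

open Classical in
/-- The shooting map `C ↦ U_II(1) - U₁`, where `U` is the solution of the integrated profile
problem with parameter `C`; it is meaningful for those `C` for which `U` exists on `[0,1]`. -/
noncomputable def shootingMap (f : StateVec r m → StateVec r m)
    (B₂₂ : StateVec r m → Matrix (Fin m) (Fin m) ℝ)
    (U₀ : StateVec r m) (U₁ : Fin m → ℝ) (C : Fin m → ℝ) : Fin m → ℝ :=
  if h : ∃ U, IsShootingSolution f B₂₂ U₀ C U then partII (h.choose 1) - U₁ else 0

/-- The parameter `C = U_II'(0)` of a profile `U`. -/
noncomputable def profileParam (U : ℝ → StateVec r m) : Fin m → ℝ :=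
  derivWithin (fun y => partII (U y)) (Icc 0 1) 0

/-- The profile `U` is nondegenerate: it corresponds to a root `C = U_II'(0)` of the shooting map,
the shooting map is well defined (the profile problem is uniquely solvable, and solvable on
`[0,1]` for all parameters near `C`), and its differential at `C` exists and has full rank. -/
structure IsNondegenerate (f : StateVec r m → StateVec r m)
    (B₂₂ : StateVec r m → Matrix (Fin m) (Fin m) ℝ)
    (U₀ : StateVec r m) (U₁ : Fin m → ℝ) (U : ℝ → StateVec r m) : Prop where
  shooting : IsShootingSolution f B₂₂ U₀ (profileParam U) U
  unique : ∀ C W W', IsShootingSolution f B₂₂ U₀ C W → IsShootingSolution f B₂₂ U₀ C W' →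
    EqOn W W' (Icc 0 1)
  solvable : ∀ᶠ C in 𝓝 (profileParam U), ∃ W, IsShootingSolution f B₂₂ U₀ C W
  root : shootingMap f B₂₂ U₀ U₁ (profileParam U) = 0
  fullRank : ∃ D : (Fin m → ℝ) ≃L[ℝ] (Fin m → ℝ),
    HasFDerivAt (shootingMap f B₂₂ U₀ U₁) (D : (Fin m → ℝ) →L[ℝ] (Fin m → ℝ)) (profileParam U)

/-! ### The linearized operator and spectral stability -/

/-- `L²((0,1); ℂⁿ)`. (The fibre `ℂⁿ` carries the sup norm; the resulting norm is equivalent to the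
Hilbert norm.) -/
abbrev L2 (r m : ℕ) : Type :=
  Lp (Fin r ⊕ Fin m → ℂ) 2 ((volume : Measure ℝ).restrict (Icc 0 1))

/-- A real matrix, regarded as a complex one. -/
def toC {ι : Type*} (M : Matrix ι ι ℝ) : Matrix ι ι ℂ := M.map (fun a : ℝ => (a : ℂ))

/-- `dB(U) V`, the derivative of the matrix field `B` at `U` in the complex direction `V`. -/
noncomputable def dVisc (B₂₂ : StateVec r m → Matrix (Fin m) (Fin m) ℝ) (U : StateVec r m)
    (V : Fin r ⊕ Fin m → ℂ) : Matrix (Fin r ⊕ Fin m) (Fin r ⊕ Fin m) ℂ :=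
  Matrix.of fun i j => ∑ k, ((fderiv ℝ (fun W => visc B₂₂ W i j) U (Pi.single k 1) : ℝ) : ℂ) * V k

/-- The linearized flux `B(Û) V_x + (dB(Û) V) Û_x - A(Û) V` at a point with `Û = U`, `Û_x = U'`,
`V = v`, `V_x = w`. -/
noncomputable def linFlux (f : StateVec r m → StateVec r m)
    (B₂₂ : StateVec r m → Matrix (Fin m) (Fin m) ℝ) (U U' : StateVec r m)
    (v w : Fin r ⊕ Fin m → ℂ) : Fin r ⊕ Fin m → ℂ :=
  toC (visc B₂₂ U) *ᵥ w + dVisc B₂₂ U v *ᵥ (fun k => (U' k : ℂ)) - toC (jac f U) *ᵥ v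

/-- The graph of the linearized operator
`L V = (B(Û) V_x + (dB(Û) V) Û_x - A(Û) V)_x` about the steady state `Û`, as an unbounded operator
on `L²((0,1); ℂⁿ)`: `V` lies in `H¹` (it is the integral of an `L²` function `w = V_x`) with
`V(0) = 0` and `V_II(1) = 0`, the linearized flux lies in `H¹`, and its weak derivative is `G`. -/
def LinearizedGraph (f : StateVec r m → StateVec r m)
    (B₂₂ : StateVec r m → Matrix (Fin m) (Fin m) ℝ) (Û : ℝ → StateVec r m)
    (V G : L2 r m) : Prop :=
  ∃ (v : ℝ → Fin r ⊕ Fin m → ℂ) (w : L2 r m) (c : Fin r ⊕ Fin m → ℂ),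
    (∀ᵐ x ∂((volume : Measure ℝ).restrict (Icc 0 1)), V x = v x) ∧
    (∀ x ∈ Icc (0 : ℝ) 1, v x = ∫ y in (0 : ℝ)..x, w y) ∧
    (∀ j, v 1 (Sum.inr j) = 0) ∧
    ∀ᵐ x ∂((volume : Measure ℝ).restrict (Icc 0 1)),
      linFlux f B₂₂ (Û x) (deriv Û x) (v x) (w x) = c + ∫ y in (0 : ℝ)..x, G y

/-- `lam` is in the resolvent set of the linearized operator `L` about `Û`: the operator `lam - L`
is a bijection from the domain of `L` onto `L²`, with bounded inverse `R`. -/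
def InResolventSet (f : StateVec r m → StateVec r m)
    (B₂₂ : StateVec r m → Matrix (Fin m) (Fin m) ℝ) (Û : ℝ → StateVec r m) (lam : ℂ) : Prop :=
  ∃ R : L2 r m →L[ℂ] L2 r m, ∀ F V : L2 r m,
    R F = V ↔ LinearizedGraph f B₂₂ Û V (lam • V - F)

/-- Spectral stability: the linearized operator has no spectrum in `{Re lam ≥ 0}`. -/
def IsSpectrallyStable (f : StateVec r m → StateVec r m)
    (B₂₂ : StateVec r m → Matrix (Fin m) (Fin m) ℝ) (Û : ℝ → StateVec r m) : Prop :=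
  ∀ lam : ℂ, 0 ≤ lam.re → InResolventSet f B₂₂ Û lam

end ViscousLaw

/-!
# Constant steady states of viscous systems of conservation laws on an interval

*The structure of the entropy.* Since `dη df = dq`, the matrix `d²η A` is symmetric. The quadratic
form of `d²η B` is nonnegative and vanishes on the vectors `(v_I, 0)`, so these lie in the kernel of
its symmetrization; as `B₂₂` is invertible, this forces the off-diagonal blocks of `d²η` to be zero
(`hess_eq_fromBlocks`). So `d²η` is a block-diagonal symmetrizer, and `(d²η)₁₁ A₁₁` is symmetric;
it inherits positivity from the spectrum of `A₁₁`. Consequently the mixed map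
`U ↦ (f_I(U), U_II)` is globally injective (`mixedMap_injective`): with `U_II` frozen, along a path
on which the gradient `∂η/∂U_I` moves linearly in a direction `δ`, the function `δ · f_I` strictly
increases. Such a path exists between any two points because the gradients of a strictly convex
function contain with two points the segment between them.

*Uniqueness* (`IsSteadySolution.eq_const`). The total flux `f(U) - B(U) U'` is a constant `c`, so
`f_I(U) = f_I(U₀)` and, by injectivity of the mixed map, `U(1) = U(0)`. The function
`q(U) - dη(U) (f(U) - c)` has derivative `-d²η(U) (U', B(U) U') ≤ 0` and equal values at both ends;
hence `U_II' = 0`, and `U` is constant.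

*Nondegeneracy* (`isNondegenerate_of_const`). On the set `f_I(U) = f_I(U₀)` the component `U_II` is
a coordinate, and the profile problem becomes an ordinary differential equation for it. The implicit
function theorem in `C([0,1])` (`exists_parameter_flow`) solves it for small `C`; the differential
of the shooting map at `C = 0` is the endpoint map of the linearized equation. It is injective
(`eq_zero_of_linearized_profile`) by an energy argument with the symmetrizer `S`.

*Spectral stability* (`isSpectrallyStable_of_const`). With `Q = ∫ V`, the resolvent equation is a
linear first-order system for `(V_II, Q)` with an unknown flux constant `c`, which has to be chosen
such that `V_II(1) = 0`. A homogeneous solution with `Re λ ≥ 0` has `c = 0`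
(`SymmetrizedPair.flux_eq_zero`): with the flux `J = B V' - A V`, the function
`Re (V* S J) + ½ V* S A V` is nondecreasing, vanishes at `0` and is nonpositive at `1`, so that its
derivative `Re (V'* S B V') + Re λ V* S V` vanishes. Therefore `c ↦ V_II(1)` is invertible, which
gives existence with a bound (`SymmetrizedPair.exists_constantGraph`) and uniqueness
(`SymmetrizedPair.constantGraph_eq_zero`).
-/

namespace ViscousLaw

/-! ### Symmetrizers and positivity -/

section Matrices

variable {ι : Type*} [Fintype ι]

lemma dotProduct_mulVec_pos_of_posDef {M : Matrix ι ι ℝ} (hM : M.PosDef) {x : ι → ℝ}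
    (hx : x ≠ 0) : 0 < x ⬝ᵥ M *ᵥ x := by
  simpa using hM.dotProduct_mulVec_pos hx

lemma dotProduct_transpose_mulVec (M : Matrix ι ι ℝ) (x y : ι → ℝ) :
    x ⬝ᵥ Mᵀ *ᵥ y = y ⬝ᵥ M *ᵥ x := by
  rw [Matrix.mulVec_transpose, dotProduct_comm, Matrix.dotProduct_mulVec]

lemma dotProduct_mulVec_comm {M : Matrix ι ι ℝ} (hM : M.IsSymm) (x y : ι → ℝ) :
    x ⬝ᵥ M *ᵥ y = y ⬝ᵥ M *ᵥ x := by
  conv_lhs => rw [← hM.eq]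
  exact dotProduct_transpose_mulVec M x y

lemma dotProduct_mulVec_pos_of_add_transpose {M : Matrix ι ι ℝ} (hM : (M + Mᵀ).PosDef)
    {x : ι → ℝ} (hx : x ≠ 0) : 0 < x ⬝ᵥ M *ᵥ x := by
  have := dotProduct_mulVec_pos_of_posDef hM hx
  rw [Matrix.add_mulVec, dotProduct_add, dotProduct_transpose_mulVec] at this
  linarith

lemma isUnit_of_dotProduct_mulVec_pos [DecidableEq ι] {M : Matrix ι ι ℝ}
    (hM : ∀ x, x ≠ 0 → 0 < x ⬝ᵥ M *ᵥ x) : IsUnit M := by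
  rw [Matrix.isUnit_iff_isUnit_det, isUnit_iff_ne_zero]
  intro h
  obtain ⟨v, hv, hv0⟩ := Matrix.exists_mulVec_eq_zero_iff.mpr h
  simpa [hv0] using hM v hv

lemma ofReal_mem_spectrum_map [DecidableEq ι] {A : Matrix ι ι ℝ} {t : ℝ} {v : ι → ℝ}
    (hv : v ≠ 0) (h : A *ᵥ v = t • v) :
    (t : ℂ) ∈ spectrum ℂ (A.map (fun a : ℝ => (a : ℂ))) := by
  rw [spectrum.mem_iff, Matrix.isUnit_iff_isUnit_det, isUnit_iff_ne_zero, not_not]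
  refine Matrix.exists_mulVec_eq_zero_iff.mp ⟨fun i => (v i : ℂ), ?_, ?_⟩
  · exact fun h0 => hv (funext fun i => by simpa using congrFun h0 i)
  · rw [Matrix.sub_mulVec, sub_eq_zero, Algebra.algebraMap_eq_smul_one, Matrix.smul_mulVec,
      Matrix.one_mulVec]
    funext i
    have := congrFun h i
    simp only [Matrix.mulVec, dotProduct, Pi.smul_apply, smul_eq_mul] at this
    simp only [Matrix.mulVec, dotProduct, Pi.smul_apply, smul_eq_mul, Matrix.map_apply]
    exact_mod_cast this.symm

open scoped MatrixOrder in
/-- If `S > 0` and `S A` is symmetric, then `S A` inherits positivity from the spectrum of `A`: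
writing `S = Yᴴ Y`, the matrix `Y A Y⁻¹` is symmetric and similar to `A`, while
`S A = Yᴴ (Y A Y⁻¹) Y`. -/
lemma posDef_mul_of_spectrum_pos [DecidableEq ι] {S A : Matrix ι ι ℝ} (hS : S.PosDef)
    (hSA : (S * A).IsSymm)
    (hA : ∀ z ∈ spectrum ℂ (A.map (fun a : ℝ => (a : ℂ))), ∃ t : ℝ, 0 < t ∧ z = (t : ℂ)) :
    (S * A).PosDef := by
  obtain ⟨Y, hY⟩ : ∃ Y : Matrix ι ι ℝ, S = star Y * Y :=
    CStarAlgebra.nonneg_iff_eq_star_mul_self.mp hS.posSemidef.nonneg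
  have hYu : IsUnit Y := by
    have := hS.isUnit
    rw [Matrix.isUnit_iff_isUnit_det] at this ⊢
    rw [hY, Matrix.det_mul] at this
    exact isUnit_of_mul_isUnit_right this
  have hYd : IsUnit Y.det := (Matrix.isUnit_iff_isUnit_det _).mp hYu
  set T := Y * A * Y⁻¹ with hT
  have hST : S * A = star Y * T * Y := by
    rw [hT, hY]
    simp only [Matrix.mul_assoc, Matrix.nonsing_inv_mul _ hYd, Matrix.mul_one]
  have hTe : T = (star Y)⁻¹ * (S * A) * Y⁻¹ := by
    have hYs : IsUnit (star Y).det := by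
      rw [Matrix.star_eq_conjTranspose, Matrix.det_conjTranspose]; exact hYd.star
    rw [hST]
    simp only [Matrix.mul_assoc, Matrix.mul_nonsing_inv _ hYd, Matrix.mul_one]
    rw [← Matrix.mul_assoc, Matrix.nonsing_inv_mul _ hYs, Matrix.one_mul]
  have hTh : T.IsHermitian := by
    rw [Matrix.IsHermitian, hTe, Matrix.star_eq_conjTranspose]
    simp only [Matrix.conjTranspose_eq_transpose_of_trivial, Matrix.transpose_mul,
      Matrix.transpose_nonsing_inv, Matrix.transpose_transpose] at hSA ⊢
    have h2 : Aᵀ * Sᵀ = S * A := by rw [← Matrix.transpose_mul]; exact hSA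
    simp only [h2, Matrix.mul_assoc]
  rw [hST, Matrix.IsUnit.posDef_star_left_conjugate_iff hYu, hTh.posDef_iff_eigenvalues_pos]
  intro j
  set x : ι → ℝ := (hTh.eigenvectorBasis j).ofLp with hx
  have hx0 : x ≠ 0 := fun h => hTh.eigenvectorBasis.orthonormal.ne_zero j (by
    ext i; exact congrFun h i)
  have hxe : T *ᵥ x = hTh.eigenvalues j • x := hTh.mulVec_eigenvectorBasis j
  have hYx : Y *ᵥ (Y⁻¹ *ᵥ x) = x := by
    rw [Matrix.mulVec_mulVec, Matrix.mul_nonsing_inv _ hYd, Matrix.one_mulVec]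
  obtain ⟨t, ht, htz⟩ := hA _ (ofReal_mem_spectrum_map (t := hTh.eigenvalues j) (v := Y⁻¹ *ᵥ x)
    (fun h => hx0 (by rw [← hYx, h, Matrix.mulVec_zero])) (by
      rw [← Matrix.mulVec_smul, ← hxe, hT, Matrix.mulVec_mulVec, Matrix.mulVec_mulVec]
      simp only [← Matrix.mul_assoc, Matrix.nonsing_inv_mul _ hYd, Matrix.one_mul]))
  rw [Complex.ofReal_injective htz]; exact ht

/-- The real part of the sesquilinear form of a real matrix splits over real and imaginary
parts. -/
lemma re_star_dotProduct_toC_mulVec (M : Matrix ι ι ℝ) (z w : ι → ℂ) :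
    (star z ⬝ᵥ toC M *ᵥ w).re =
      (fun i => (z i).re) ⬝ᵥ M *ᵥ (fun i => (w i).re) +
      (fun i => (z i).im) ⬝ᵥ M *ᵥ (fun i => (w i).im) := by
  simp only [toC, dotProduct, Matrix.mulVec, Matrix.map_apply, Finset.mul_sum, Complex.re_sum,
    ← Finset.sum_add_distrib]
  refine Finset.sum_congr rfl fun i _ => Finset.sum_congr rfl fun j _ => ?_
  simp [Complex.mul_re, Complex.mul_im]

lemma re_toC_nonneg {M : Matrix ι ι ℝ} (hM : ∀ x, x ≠ 0 → 0 < x ⬝ᵥ M *ᵥ x) (z : ι → ℂ) :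
    0 ≤ (star z ⬝ᵥ toC M *ᵥ z).re := by
  have h0 : ∀ x, 0 ≤ x ⬝ᵥ M *ᵥ x := fun x => by
    by_cases hx : x = 0
    · simp [hx]
    · exact (hM x hx).le
  rw [re_star_dotProduct_toC_mulVec]
  exact add_nonneg (h0 _) (h0 _)

lemma eq_zero_of_re_toC_eq_zero {M : Matrix ι ι ℝ} (hM : ∀ x, x ≠ 0 → 0 < x ⬝ᵥ M *ᵥ x)
    {z : ι → ℂ} (hz : (star z ⬝ᵥ toC M *ᵥ z).re = 0) : z = 0 := by
  have h0 : ∀ x, 0 ≤ x ⬝ᵥ M *ᵥ x := fun x => by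
    by_cases hx : x = 0
    · simp [hx]
    · exact (hM x hx).le
  rw [re_star_dotProduct_toC_mulVec] at hz
  have h1 := h0 (fun i => (z i).re)
  have h2 := h0 (fun i => (z i).im)
  have hre : (fun i => (z i).re) = 0 := by
    by_contra h; linarith [hM _ h]
  have him : (fun i => (z i).im) = 0 := by
    by_contra h; linarith [hM _ h]
  funext i
  exact Complex.ext (congrFun hre i) (congrFun him i)

end Matrices

variable {r m : ℕ}

lemma toBlocks₁₁_fromBlocks_mul (S₁₁ : Matrix (Fin r) (Fin r) ℝ)
    (S₂₂ : Matrix (Fin m) (Fin m) ℝ) (A : Matrix (Fin r ⊕ Fin m) (Fin r ⊕ Fin m) ℝ) :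
    (Matrix.fromBlocks S₁₁ 0 0 S₂₂ * A).toBlocks₁₁ = S₁₁ * A.toBlocks₁₁ := by
  conv_lhs => rw [← Matrix.fromBlocks_toBlocks A, Matrix.fromBlocks_multiply]
  simp

/-- A block-diagonal symmetrizer makes the hyperbolic block `S₁₁ A₁₁` positive definite as soon as
the spectrum of `A₁₁` is positive. -/
lemma posDef_block_mul {S₁₁ : Matrix (Fin r) (Fin r) ℝ} {S₂₂ : Matrix (Fin m) (Fin m) ℝ}
    {A : Matrix (Fin r ⊕ Fin m) (Fin r ⊕ Fin m) ℝ}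
    (hS : (Matrix.fromBlocks S₁₁ 0 0 S₂₂).PosDef)
    (hSA : (Matrix.fromBlocks S₁₁ 0 0 S₂₂ * A).IsSymm)
    (hA : ∀ z ∈ spectrum ℂ (A.toBlocks₁₁.map (fun a : ℝ => (a : ℂ))),
      ∃ t : ℝ, 0 < t ∧ z = (t : ℂ)) :
    (S₁₁ * A.toBlocks₁₁).PosDef := by
  refine posDef_mul_of_spectrum_pos ?_ ?_ hA
  · have := hS.submatrix (e := Sum.inl) Sum.inl_injective
    convert this using 1
    ext; rfl
  · rw [← toBlocks₁₁_fromBlocks_mul S₁₁ S₂₂ A]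
    ext i j
    exact congrFun (congrFun hSA.eq (Sum.inl i)) (Sum.inl j)

lemma eq_zero_of_mulVec_eq_zero_of_spectrum_pos {A : Matrix (Fin r) (Fin r) ℝ}
    (hA : ∀ z ∈ spectrum ℂ (A.map (fun a : ℝ => (a : ℂ))), ∃ t : ℝ, 0 < t ∧ z = (t : ℂ))
    {v : Fin r → ℝ} (hv : A *ᵥ v = 0) : v = 0 := by
  by_contra h
  obtain ⟨t, ht, h0⟩ := hA _ (ofReal_mem_spectrum_map (t := 0) h (by simpa using hv))
  exact ht.ne (Complex.ofReal_injective h0)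

/-! ### Gradient paths of a strictly convex function and global injectivity -/

section GradientPath

variable {E : Type*} [NormedAddCommGroup E] [NormedSpace ℝ E] {φ : E → ℝ}

lemma fderiv_sub_apply_pos (hφ : ContDiff ℝ 2 φ)
    (hpos : ∀ u d, d ≠ 0 → 0 < fderiv ℝ (fderiv ℝ φ) u d d) {u v : E} (huv : u ≠ v) :
    0 < (fderiv ℝ φ u - fderiv ℝ φ v) (u - v) := by
  have hD : ContDiff ℝ 1 (fderiv ℝ φ) := hφ.fderiv_right (by norm_num)
  have hder : ∀ t : ℝ, HasDerivAt (fun t : ℝ => fderiv ℝ φ (v + t • (u - v)) (u - v))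
      (fderiv ℝ (fderiv ℝ φ) (v + t • (u - v)) (u - v) (u - v)) t := fun t => by
    have h1 : HasDerivAt (fun t : ℝ => v + t • (u - v)) (u - v) t := by
      simpa using ((hasDerivAt_id t).smul_const (u - v)).const_add v
    have h2 := ((hD.differentiable one_ne_zero _).hasFDerivAt.comp_hasDerivAt t h1)
    exact (ContinuousLinearMap.apply ℝ ℝ (u - v)).hasFDerivAt.comp_hasDerivAt t h2
  have hmono : StrictMono (fun t : ℝ => fderiv ℝ φ (v + t • (u - v)) (u - v)) :=
    strictMono_of_deriv_pos fun t => by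
      rw [(hder t).deriv]; exact hpos _ _ (sub_ne_zero.mpr huv)
  have := hmono (zero_lt_one' ℝ)
  simpa using this

lemma fderiv_injective_of_pos (hφ : ContDiff ℝ 2 φ)
    (hpos : ∀ u d, d ≠ 0 → 0 < fderiv ℝ (fderiv ℝ φ) u d d) :
    Function.Injective (fderiv ℝ φ) := by
  intro u v h
  by_contra huv
  simpa [h] using fderiv_sub_apply_pos hφ hpos huv

lemma tangent_le (hφ : ContDiff ℝ 2 φ)
    (hpos : ∀ u d, d ≠ 0 → 0 < fderiv ℝ (fderiv ℝ φ) u d d) (u v : E) :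
    φ v + fderiv ℝ φ v (u - v) ≤ φ u := by
  have hder : ∀ t : ℝ, HasDerivAt (fun t : ℝ => φ (v + t • (u - v)))
      (fderiv ℝ φ (v + t • (u - v)) (u - v)) t := fun t => by
    have h1 : HasDerivAt (fun t : ℝ => v + t • (u - v)) (u - v) t := by
      simpa using ((hasDerivAt_id t).smul_const (u - v)).const_add v
    exact (hφ.differentiable two_ne_zero _).hasFDerivAt.comp_hasDerivAt t h1
  obtain ⟨c, hc, hc'⟩ := exists_hasDerivAt_eq_slope _ _ (zero_lt_one' ℝ)
    (fun t _ => (hder t).continuousAt.continuousWithinAt) (fun t _ => hder t)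
  simp only [zero_smul, one_smul, add_zero, add_sub_cancel, sub_zero, div_one] at hc'
  by_cases huv : u = v
  · simp [huv]
  have hne : v + c • (u - v) ≠ v := by
    simp [hc.1.ne', sub_ne_zero.mpr huv]
  have := fderiv_sub_apply_pos hφ hpos hne
  rw [add_sub_cancel_left, map_smul, smul_eq_mul, sub_apply] at this
  have := pos_of_mul_pos_right this hc.1.le
  linarith

/-- The segment between two gradients of a strictly convex `C²` function consists of gradients:
`φ - w` is coercive for `w` strictly inside the segment, and its minimum has gradient `w`. -/
lemma exists_fderiv_eq_of_mem_segment [FiniteDimensional ℝ E] (hφ : ContDiff ℝ 2 φ)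
    (hpos : ∀ u d, d ≠ 0 → 0 < fderiv ℝ (fderiv ℝ φ) u d d) (a a' : E) {s : ℝ}
    (hs : s ∈ Icc (0 : ℝ) 1) :
    ∃ u, fderiv ℝ φ u = fderiv ℝ φ a + s • (fderiv ℝ φ a' - fderiv ℝ φ a) := by
  rcases hs.2.eq_or_lt with rfl | hs1
  · exact ⟨a', by simp⟩
  have hDc : Continuous (fderiv ℝ φ) := hφ.continuous_fderiv two_ne_zero
  set D := fderiv ℝ φ with hDdef
  obtain ⟨c, hc, hcle⟩ := (isCompact_sphere (0 : E) 1).exists_forall_le'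
    (f := fun e => (D (a + e) - D a) e) (a := 0)
    (by fun_prop) (fun e he => by
      have he0 : e ≠ 0 := by
        rintro rfl; simp at he
      simpa using fderiv_sub_apply_pos hφ hpos (u := a + e) (v := a) (by simpa using he0))
  have hgrow : ∀ u, 1 ≤ ‖u - a‖ → φ a + D a (u - a) + c * (‖u - a‖ - 1) ≤ φ u := by
    intro u hu
    have hn : ‖u - a‖ ≠ 0 := by linarith
    set e := ‖u - a‖⁻¹ • (u - a) with he
    have hue : u - a = ‖u - a‖ • e := by rw [he, smul_inv_smul₀ hn]
    have hes : e ∈ Metric.sphere (0 : E) 1 := by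
      rw [mem_sphere_zero_iff_norm, he, norm_smul, norm_inv, norm_norm, inv_mul_cancel₀ hn]
    have h1 := tangent_le hφ hpos u (a + e)
    have h2 := tangent_le hφ hpos (a + e) a
    have h3 : u - (a + e) = (‖u - a‖ - 1) • e := by
      rw [sub_smul, one_smul, ← hue]; abel
    have h4 := hcle e hes
    have h5 : D a (u - a) = ‖u - a‖ * D a e := by
      conv_lhs => rw [hue]
      simp
    rw [h3, map_smul, smul_eq_mul] at h1
    rw [add_sub_cancel_left] at h2
    simp only [sub_apply] at h4
    rw [h5]
    nlinarith [mul_le_mul_of_nonneg_left h4 (sub_nonneg.mpr hu)]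
  set w := D a + s • (D a' - D a) with hw
  have hcont : Continuous fun u => φ u - w u := hφ.continuous.sub w.continuous
  obtain ⟨u, hu⟩ := hcont.exists_forall_le' a (by
    have hlim : Filter.Tendsto (fun u : E => ‖u - a‖) (Filter.cocompact E) Filter.atTop := by
      refine Filter.tendsto_atTop_mono (fun u => norm_sub_norm_le u a) ?_
      exact Filter.tendsto_atTop_add_const_right _ (-‖a‖) tendsto_norm_cocompact_atTop
    set R : ℝ := 1 + s * (φ a - D a' a - (φ a' - D a' a')) / (c * (1 - s)) with hR
    filter_upwards [hlim.eventually_ge_atTop 1, hlim.eventually_ge_atTop R] with u h1 h2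
    have h3 := hgrow u h1
    have h4 := tangent_le hφ hpos u a'
    have hc1 : 0 < c * (1 - s) := mul_pos hc (by linarith)
    have h5 : s * (φ a - D a' a - (φ a' - D a' a')) ≤ (c * (1 - s)) * (‖u - a‖ - 1) := by
      have : s * (φ a - D a' a - (φ a' - D a' a')) / (c * (1 - s)) ≤ ‖u - a‖ - 1 := by linarith
      rwa [div_le_iff₀' hc1] at this
    simp only [hw, add_apply, smul_apply,
      sub_apply, smul_eq_mul, map_sub] at h3 h4 h5 ⊢
    nlinarith [mul_le_mul_of_nonneg_left h3 (by linarith : 0 ≤ 1 - s),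
      mul_le_mul_of_nonneg_left h4 hs.1])
  refine ⟨u, ?_⟩
  have hmin : IsLocalMin (fun u => φ u - w u) u := Filter.Eventually.of_forall hu
  have hd : HasFDerivAt (fun u => φ u - w u) (D u - w) u :=
    (hφ.differentiable two_ne_zero u).hasFDerivAt.sub w.hasFDerivAt
  exact sub_eq_zero.mp (hmin.hasFDerivAt_eq_zero hd)

/-- The path along which the gradient of `φ` moves linearly. -/
lemma exists_gradient_path [FiniteDimensional ℝ E] (hφ : ContDiff ℝ 2 φ)
    (hpos : ∀ u d, d ≠ 0 → 0 < fderiv ℝ (fderiv ℝ φ) u d d) (a a' : E) :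
    ∃ u : ℝ → E, u 0 = a ∧ u 1 = a' ∧ ∀ s ∈ Icc (0 : ℝ) 1, ∃ d, HasDerivAt u d s ∧
      fderiv ℝ (fderiv ℝ φ) (u s) d = fderiv ℝ φ a' - fderiv ℝ φ a := by
  have hD : ContDiff ℝ 1 (fderiv ℝ φ) := hφ.fderiv_right (by norm_num)
  have hinj := fderiv_injective_of_pos hφ hpos
  have hleft : ∀ x, Function.invFun (fderiv ℝ φ) (fderiv ℝ φ x) = x :=
    Function.leftInverse_invFun hinj
  refine ⟨fun s => Function.invFun (fderiv ℝ φ)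
    (fderiv ℝ φ a + s • (fderiv ℝ φ a' - fderiv ℝ φ a)), by simp [hleft], by simp [hleft], ?_⟩
  intro s hs
  obtain ⟨x, hx⟩ := exists_fderiv_eq_of_mem_segment hφ hpos a a' hs
  have hfin : Module.finrank ℝ E = Module.finrank ℝ (E →L[ℝ] ℝ) := by
    rw [← (LinearMap.toContinuousLinearMap (𝕜 := ℝ) (E := E) (F' := ℝ)).finrank_eq]
    exact (Subspace.dual_finrank_eq (K := ℝ) (V := E)).symm
  have hker : Function.Injective (fderiv ℝ (fderiv ℝ φ) x : E →ₗ[ℝ] (E →L[ℝ] ℝ)) := by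
    rw [injective_iff_map_eq_zero]
    intro d hd
    by_contra h
    have := hpos x d h
    rw [show fderiv ℝ (fderiv ℝ φ) x d = 0 from hd] at this
    simp at this
  set e : E ≃L[ℝ] (E →L[ℝ] ℝ) :=
    (LinearMap.linearEquivOfInjective _ hker hfin).toContinuousLinearEquiv with he
  have hee : (e : E →L[ℝ] (E →L[ℝ] ℝ)) = fderiv ℝ (fderiv ℝ φ) x := by
    ext d : 1; rfl
  have hst : HasStrictFDerivAt (fderiv ℝ φ) (e : E →L[ℝ] (E →L[ℝ] ℝ)) x := by
    rw [hee]
    exact hD.contDiffAt.hasStrictFDerivAt one_ne_zero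
  have hinv := (hst.to_local_left_inverse (g := Function.invFun (fderiv ℝ φ))
    (Filter.Eventually.of_forall hleft)).hasFDerivAt
  rw [hx] at hinv
  refine ⟨e.symm (fderiv ℝ φ a' - fderiv ℝ φ a), ?_, ?_⟩
  · have h1 : HasDerivAt (fun s : ℝ => fderiv ℝ φ a + s • (fderiv ℝ φ a' - fderiv ℝ φ a))
        (fderiv ℝ φ a' - fderiv ℝ φ a) s := by
      simpa using ((hasDerivAt_id s).smul_const
        (fderiv ℝ φ a' - fderiv ℝ φ a)).const_add (fderiv ℝ φ a)
    exact hinv.comp_hasDerivAt s h1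
  · beta_reduce
    rw [← hx, hleft, ← hee]
    exact e.apply_symm_apply _

/-- If `d²φ > 0` and `d²φ(u)(d, dg(u) d) > 0` for `d ≠ 0`, then `g` is injective: along the path
on which `dφ` moves linearly in the direction `δ`, the function `δ ∘ g` strictly increases. -/
lemma injective_of_convex_symmetrizer [FiniteDimensional ℝ E] (hφ : ContDiff ℝ 2 φ)
    (hpos : ∀ u d, d ≠ 0 → 0 < fderiv ℝ (fderiv ℝ φ) u d d) {g : E → E}
    (hg : Differentiable ℝ g)
    (hgpos : ∀ u d, d ≠ 0 → 0 < fderiv ℝ (fderiv ℝ φ) u d (fderiv ℝ g u d)) :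
    Function.Injective g := by
  intro a a' haa
  by_contra hne
  obtain ⟨u, hu0, hu1, hu⟩ := exists_gradient_path hφ hpos a a'
  set δ := fderiv ℝ φ a' - fderiv ℝ φ a with hδ
  have hδ0 : δ ≠ 0 := sub_ne_zero.mpr fun h => hne (fderiv_injective_of_pos hφ hpos h).symm
  choose! d hd hdδ using hu
  have hder : ∀ s ∈ Icc (0 : ℝ) 1,
      HasDerivAt (fun s => δ (g (u s))) (δ (fderiv ℝ g (u s) (d s))) s := fun s hs =>
    δ.hasFDerivAt.comp_hasDerivAt s ((hg (u s)).hasFDerivAt.comp_hasDerivAt s (hd s hs))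
  have hmono : StrictMonoOn (fun s => δ (g (u s))) (Icc (0 : ℝ) 1) := by
    refine strictMonoOn_of_deriv_pos (convex_Icc 0 1)
      (fun s hs => (hder s hs).continuousAt.continuousWithinAt) fun s hs => ?_
    rw [interior_Icc] at hs
    have hs' := Ioo_subset_Icc_self hs
    have hd0 : d s ≠ 0 := fun h => hδ0 (by rw [← hdδ s hs', h, map_zero])
    rw [(hder s hs').deriv, ← hdδ s hs']
    exact hgpos _ _ hd0
  have := hmono (left_mem_Icc.mpr zero_le_one) (right_mem_Icc.mpr zero_le_one) zero_lt_one
  simp [hu0, hu1, haa] at this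

end GradientPath

/-! ### Block decomposition of states and the mixed map `(f_I, U_II)` -/

section Glue

variable (𝕜 : Type*) [NontriviallyNormedField 𝕜]

/-- The projection `U ↦ U_I` as a continuous linear map. -/
def projI : (Fin r ⊕ Fin m → 𝕜) →L[𝕜] (Fin r → 𝕜) :=
  ContinuousLinearMap.pi fun i => ContinuousLinearMap.proj (Sum.inl i)

/-- The projection `U ↦ U_II` as a continuous linear map. -/
def projII : (Fin r ⊕ Fin m → 𝕜) →L[𝕜] (Fin m → 𝕜) :=
  ContinuousLinearMap.pi fun j => ContinuousLinearMap.proj (Sum.inr j)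

/-- The map `(U_I, U_II) ↦ U` as a continuous linear map. -/
def glue : ((Fin r → 𝕜) × (Fin m → 𝕜)) →L[𝕜] (Fin r ⊕ Fin m → 𝕜) :=
  ContinuousLinearMap.pi fun k => Sum.rec
    (fun i => (ContinuousLinearMap.proj i).comp (ContinuousLinearMap.fst 𝕜 _ _))
    (fun j => (ContinuousLinearMap.proj j).comp (ContinuousLinearMap.snd 𝕜 _ _)) k

@[simp] lemma projI_apply (U : Fin r ⊕ Fin m → 𝕜) (i : Fin r) : projI 𝕜 U i = U (Sum.inl i) := rfl

@[simp] lemma projII_apply (U : Fin r ⊕ Fin m → 𝕜) (j : Fin m) :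
    projII 𝕜 U j = U (Sum.inr j) := rfl

@[simp] lemma glue_inl (p : (Fin r → 𝕜) × (Fin m → 𝕜)) (i : Fin r) :
    glue 𝕜 p (Sum.inl i) = p.1 i := rfl

@[simp] lemma glue_inr (p : (Fin r → 𝕜) × (Fin m → 𝕜)) (j : Fin m) :
    glue 𝕜 p (Sum.inr j) = p.2 j := rfl

@[simp] lemma projI_glue (p : (Fin r → 𝕜) × (Fin m → 𝕜)) : projI 𝕜 (glue 𝕜 p) = p.1 := rfl

@[simp] lemma projII_glue (p : (Fin r → 𝕜) × (Fin m → 𝕜)) : projII 𝕜 (glue 𝕜 p) = p.2 := rfl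

@[simp] lemma glue_proj (U : Fin r ⊕ Fin m → 𝕜) : glue 𝕜 (projI 𝕜 U, projII 𝕜 U) = U := by
  ext k; cases k <;> rfl

end Glue

lemma partI_eq (U : StateVec r m) : partI U = projI ℝ U := rfl

lemma partII_eq (U : StateVec r m) : partII U = projII ℝ U := rfl

lemma jac_mulVec (f : StateVec r m → StateVec r m) (U v : StateVec r m) :
    jac f U *ᵥ v = fderiv ℝ f U v := by
  rw [jac, LinearMap.toMatrix'_mulVec]; rfl

lemma visc_mulVec (B₂₂ : StateVec r m → Matrix (Fin m) (Fin m) ℝ) (U v : StateVec r m) :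
    visc B₂₂ U *ᵥ v = glue ℝ (0, B₂₂ U *ᵥ projII ℝ v) := by
  rw [visc, Matrix.fromBlocks_mulVec]
  ext k; cases k
  · simp
  · simp; rfl

/-- The map `U ↦ (f_I(U), U_II)`. -/
noncomputable def mixedMap (f : StateVec r m → StateVec r m) (U : StateVec r m) : StateVec r m :=
  glue ℝ (partI (f U), partII U)

/-- The differential of `U ↦ (f_I(U), U_II)` is invertible because `A₁₁` is. -/
lemma exists_mixedMap_deriv {f : StateVec r m → StateVec r m} (hf : ContDiff ℝ ∞ f)
    (h2 : H2 f) (U : StateVec r m) :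
    ∃ e : StateVec r m ≃L[ℝ] StateVec r m,
      HasStrictFDerivAt (mixedMap f) (e : StateVec r m →L[ℝ] StateVec r m) U ∧
      ∀ v, e v = glue ℝ (projI ℝ (jac f U *ᵥ v), projII ℝ v) := by
  set L : StateVec r m →L[ℝ] StateVec r m :=
    (glue ℝ).comp (((projI ℝ).comp (fderiv ℝ f U)).prod (projII ℝ)) with hL
  have hLv : ∀ v, L v = glue ℝ (projI ℝ (jac f U *ᵥ v), projII ℝ v) := fun v => by
    rw [jac_mulVec]; rfl
  have hinj : Function.Injective (L : StateVec r m →ₗ[ℝ] StateVec r m) := by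
    rw [injective_iff_map_eq_zero]
    intro v hv
    replace hv : L v = 0 := hv
    rw [hLv] at hv
    have hII : projII ℝ v = 0 := by simpa using congrArg (projII ℝ) hv
    have hI : projI ℝ (jac f U *ᵥ v) = 0 := by simpa using congrArg (projI ℝ) hv
    have : (jac f U).toBlocks₁₁ *ᵥ projI ℝ v = 0 := by
      funext i
      have h := congrFun hI i
      rw [← glue_proj ℝ v, hII] at h
      simpa [Matrix.mulVec, dotProduct, Fintype.sum_sum_type, Matrix.toBlocks₁₁] using h
    rw [← glue_proj ℝ v, hII, eq_zero_of_mulVec_eq_zero_of_spectrum_pos (h2 U) this]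
    exact map_zero _
  refine ⟨(LinearEquiv.ofInjectiveEndo _ hinj).toContinuousLinearEquiv, ?_, hLv⟩
  have hst : HasStrictFDerivAt (mixedMap f) L U :=
    (glue ℝ).hasStrictFDerivAt.comp U (((projI ℝ).hasStrictFDerivAt.comp U
      (hf.contDiffAt.hasStrictFDerivAt (by simp))).prodMk (projII ℝ).hasStrictFDerivAt)
  convert hst using 1
  ext v : 1
  rfl

/-! ### Consequences of the convex entropy -/

lemma dotProduct_hess_mulVec (η : StateVec r m → ℝ) (U x y : StateVec r m) :
    x ⬝ᵥ hess η U *ᵥ y = fderiv ℝ (fderiv ℝ η) U x y := by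
  have hsum : ∀ z : StateVec r m, z = ∑ i, z i • Pi.single i (1 : ℝ) := fun z => by
    ext k; simp [Finset.sum_apply, Pi.single_apply]
  conv_rhs => rw [hsum x, hsum y]
  simp only [map_sum, map_smul, sum_apply, smul_apply, smul_eq_mul,
    dotProduct, Matrix.mulVec, hess, Matrix.of_apply]
  simp only [Finset.mul_sum]
  conv_rhs => rw [Finset.sum_comm]
  refine Finset.sum_congr rfl fun i _ => Finset.sum_congr rfl fun j _ => by ring

/-- `dη df = dq` makes `d²η df` symmetric, since `d²q` and `d²f` are symmetric. -/
lemma hess_mul_jac_isSymm {f : StateVec r m → StateVec r m} (hf : ContDiff ℝ ∞ f)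
    {η q : StateVec r m → ℝ} (hη : ContDiff ℝ 2 η) (hq : ContDiff ℝ 1 q)
    (hηq : ∀ U, (fderiv ℝ η U).comp (fderiv ℝ f U) = fderiv ℝ q U) (U : StateVec r m) :
    (hess η U * jac f U).IsSymm := by
  have hη' : HasFDerivAt (fderiv ℝ η) (fderiv ℝ (fderiv ℝ η) U) U :=
    ((hη.fderiv_right (m := 1) (by norm_num)).differentiable one_ne_zero U).hasFDerivAt
  have hf' : HasFDerivAt (fderiv ℝ f) (fderiv ℝ (fderiv ℝ f) U) U :=
    ((((contDiff_infty.mp hf 2 : ContDiff ℝ 2 f)).fderiv_right (m := 1)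
      (by norm_num)).differentiable one_ne_zero U).hasFDerivAt
  have hq' := hη'.clm_comp hf'
  simp_rw [hηq] at hq'
  have hsymf := second_derivative_symmetric
    (fun V => (hf.differentiable (by simp) V).hasFDerivAt) hf'
  have hsymq := second_derivative_symmetric
    (fun V => (hq.differentiable one_ne_zero V).hasFDerivAt) hq'
  have key : ∀ x y, fderiv ℝ (fderiv ℝ η) U x (fderiv ℝ f U y) =
      fderiv ℝ (fderiv ℝ η) U y (fderiv ℝ f U x) := fun x y => by
    have h := hsymq x y
    simp only [add_apply, ContinuousLinearMap.comp_apply,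
      ContinuousLinearMap.flip_apply, ContinuousLinearMap.compL_apply] at h
    rw [hsymf x y] at h
    linarith
  ext i j
  have hent : ∀ i j, (hess η U * jac f U) i j =
      fderiv ℝ (fderiv ℝ η) U (Pi.single i 1) (fderiv ℝ f U (Pi.single j 1)) := fun i j => by
    rw [← jac_mulVec, ← dotProduct_hess_mulVec, Matrix.mulVec_mulVec, single_one_dotProduct,
      Matrix.mulVec_single_one]
    rfl
  rw [Matrix.transpose_apply, hent, hent, key]

/-- A quadratic form that is nonnegative and vanishes on `U_I` has no mixed terms. -/
lemma toBlocks₁₂_eq_zero_of_posSemidef {H : Matrix (Fin r ⊕ Fin m) (Fin r ⊕ Fin m) ℝ}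
    {B : Matrix (Fin m) (Fin m) ℝ} (hB : IsUnit B)
    (hQ : (H * Matrix.fromBlocks 0 0 0 B + (H * Matrix.fromBlocks 0 0 0 B)ᵀ).PosSemidef) :
    H.toBlocks₁₂ = 0 := by
  have hHB : H * Matrix.fromBlocks 0 0 0 B =
      Matrix.fromBlocks 0 (H.toBlocks₁₂ * B) 0 (H.toBlocks₂₂ * B) := by
    conv_lhs => rw [← Matrix.fromBlocks_toBlocks H, Matrix.fromBlocks_multiply]
    simp
  rw [hHB] at hQ
  have h0 : H.toBlocks₁₂ * B = 0 := by
    ext i j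
    have h1 := (hQ.dotProduct_mulVec_zero_iff (Pi.single (Sum.inl i) 1)).mp (by
      simp)
    have h2 := congrFun h1 (Sum.inr j)
    simpa [Matrix.mulVec_single_one] using h2
  have hBd := (Matrix.isUnit_iff_isUnit_det _).mp hB
  calc H.toBlocks₁₂ = H.toBlocks₁₂ * B * B⁻¹ := by
        rw [Matrix.mul_assoc, Matrix.mul_nonsing_inv _ hBd, Matrix.mul_one]
    _ = 0 := by rw [h0, Matrix.zero_mul]

/-- The viscous compatibility forces the Hessian of an entropy to be block diagonal. -/
lemma hess_eq_fromBlocks {B₂₂ : StateVec r m → Matrix (Fin m) (Fin m) ℝ} (h1 : H1 B₂₂)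
    {η : StateVec r m → ℝ} {U : StateVec r m} (hpos : (hess η U).PosDef)
    (hQ : (hess η U * visc B₂₂ U + (hess η U * visc B₂₂ U)ᵀ).PosSemidef) :
    hess η U = Matrix.fromBlocks (hess η U).toBlocks₁₁ 0 0 (hess η U).toBlocks₂₂ := by
  have h12 := toBlocks₁₂_eq_zero_of_posSemidef (isUnit_of_dotProduct_mulVec_pos fun x hx =>
    dotProduct_mulVec_pos_of_add_transpose (h1 U) hx) hQ
  have h21 : (hess η U).toBlocks₂₁ = 0 := by
    ext j i
    have h := congrFun (congrFun hpos.isHermitian.eq (Sum.inr j)) (Sum.inl i)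
    have h' := congrFun (congrFun h12 i) j
    simp only [Matrix.conjTranspose_apply, star_trivial] at h
    exact h.symm.trans h'
  conv_lhs => rw [← Matrix.fromBlocks_toBlocks (hess η U), h12, h21]

/-- The dissipation `d²η (v, B v)` is nonnegative and vanishes only if `v_II = 0`. -/
lemma hess_visc_pos {B₂₂ : StateVec r m → Matrix (Fin m) (Fin m) ℝ} (h1 : H1 B₂₂)
    {η : StateVec r m → ℝ} {U : StateVec r m}
    (hQ : (hess η U * visc B₂₂ U + (hess η U * visc B₂₂ U)ᵀ).PosSemidef)
    (hker : ∀ v, v ⬝ᵥ ((hess η U * visc B₂₂ U + (hess η U * visc B₂₂ U)ᵀ) *ᵥ v) = 0 →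
        visc B₂₂ U *ᵥ v = 0) (v : StateVec r m) :
    0 ≤ fderiv ℝ (fderiv ℝ η) U v (visc B₂₂ U *ᵥ v) ∧
      (fderiv ℝ (fderiv ℝ η) U v (visc B₂₂ U *ᵥ v) = 0 → projII ℝ v = 0) := by
  have hv : v ⬝ᵥ ((hess η U * visc B₂₂ U + (hess η U * visc B₂₂ U)ᵀ) *ᵥ v) =
      2 * fderiv ℝ (fderiv ℝ η) U v (visc B₂₂ U *ᵥ v) := by
    rw [Matrix.add_mulVec, dotProduct_add, dotProduct_transpose_mulVec,
      ← dotProduct_hess_mulVec, Matrix.mulVec_mulVec]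
    ring
  constructor
  · have := hQ.dotProduct_mulVec_nonneg v
    rw [star_trivial, hv] at this
    linarith
  · intro h
    have := hker v (by rw [hv, h, mul_zero])
    rw [visc_mulVec] at this
    have h' : B₂₂ U *ᵥ projII ℝ v = 0 := by simpa using congrArg (projII ℝ) this
    by_contra hne
    have := dotProduct_mulVec_pos_of_add_transpose (h1 U) hne
    simp [h'] at this

/-- The map `U ↦ (f_I(U), U_II)` is globally injective: for frozen `U_II`, the function
`η(·, U_II)` is a convex entropy for `f_I(·, U_II)`. -/
lemma mixedMap_injective {f : StateVec r m → StateVec r m}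
    {B₂₂ : StateVec r m → Matrix (Fin m) (Fin m) ℝ} (h0 : H0 f B₂₂) (h1 : H1 B₂₂) (h2 : H2 f)
    (hent : HasConvexEntropy f B₂₂) : Function.Injective (mixedMap f) := by
  obtain ⟨η, q, hη, hq, hall⟩ := hent
  intro U U' hUU'
  have hII : projII ℝ U = projII ℝ U' := by simpa [mixedMap] using! congrArg (projII ℝ) hUU'
  have hI : projI ℝ (f U) = projI ℝ (f U') := by simpa [mixedMap] using! congrArg (projI ℝ) hUU'
  set b := projII ℝ U with hb
  set ι : (Fin r → ℝ) →L[ℝ] StateVec r m :=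
    (glue ℝ).comp (ContinuousLinearMap.inl ℝ _ _) with hι
  have hh : ∀ a, HasFDerivAt (fun a : Fin r → ℝ => glue ℝ (a, b)) ι a := fun a =>
    (glue ℝ).hasFDerivAt.comp a (hasFDerivAt_prodMk_left a b)
  have hφ : ContDiff ℝ 2 (fun a : Fin r → ℝ => η (glue ℝ (a, b))) :=
    hη.comp ((glue ℝ).contDiff.comp (contDiff_id.prodMk contDiff_const))
  have hφ' : fderiv ℝ (fun a : Fin r → ℝ => η (glue ℝ (a, b))) =
      fun a => (fderiv ℝ η (glue ℝ (a, b))).comp ι := by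
    funext a
    exact ((hη.differentiable two_ne_zero _).hasFDerivAt.comp a (hh a)).fderiv
  have hφ'' : ∀ a x y, fderiv ℝ (fderiv ℝ (fun a : Fin r → ℝ => η (glue ℝ (a, b)))) a x y =
      fderiv ℝ (fderiv ℝ η) (glue ℝ (a, b)) (ι x) (ι y) := fun a x y => by
    have hη' := ((hη.fderiv_right (m := 1) (by norm_num)).differentiable one_ne_zero
      (glue ℝ (a, b))).hasFDerivAt.comp a (hh a)
    have := (hη'.clm_comp (hasFDerivAt_const ι a)).fderiv
    rw [hφ']
    simp only [Function.comp_def] at this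
    rw [this]
    simp
  have hg : ∀ a, HasFDerivAt (fun a : Fin r → ℝ => projI ℝ (f (glue ℝ (a, b))))
      ((projI ℝ).comp ((fderiv ℝ f (glue ℝ (a, b))).comp ι)) a := fun a =>
    (projI ℝ).hasFDerivAt.comp a
      ((h0.1.differentiable (by simp) _).hasFDerivAt.comp a (hh a))
  have hιv : ∀ d : Fin r → ℝ, ι d = Sum.elim d 0 := fun d => by
    ext k; cases k <;> simp [hι]
  have hinj := injective_of_convex_symmetrizer hφ (fun a d hd => by
      rw [hφ'', ← dotProduct_hess_mulVec]
      refine dotProduct_mulVec_pos_of_posDef (hall _).1 fun h => hd ?_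
      rw [hιv] at h
      exact funext fun i => congrFun h (Sum.inl i))
    (fun a => (hg a).differentiableAt) (fun a d hd => by
      set V := glue ℝ (a, b) with hV
      obtain ⟨hpos, hηq, hQ, -⟩ := hall V
      have hbl := hess_eq_fromBlocks h1 hpos hQ
      have hP : ((hess η V).toBlocks₁₁ * (jac f V).toBlocks₁₁).PosDef := by
        refine posDef_block_mul (S₂₂ := (hess η V).toBlocks₂₂) ?_ ?_ (h2 V)
        · rw [← hbl]; exact hpos
        · rw [← hbl]; exact hess_mul_jac_isSymm h0.1 hη hq (fun U => (hall U).2.1) V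
      have := dotProduct_mulVec_pos_of_posDef hP hd
      rw [hφ'', ← dotProduct_hess_mulVec, (hg a).fderiv]
      simp only [ContinuousLinearMap.comp_apply]
      rw [← jac_mulVec, ← hV, hιv, hιv, hbl, Matrix.fromBlocks_mulVec, sumElim_dotProduct_sumElim]
      have hA : projI ℝ (jac f V *ᵥ Sum.elim d 0) = (jac f V).toBlocks₁₁ *ᵥ d := by
        funext i
        simp [Matrix.mulVec, dotProduct, Fintype.sum_sum_type, Matrix.toBlocks₁₁]
      rw [hA]
      simpa [Function.comp_def, Matrix.mulVec_mulVec] using! this)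
  have : projI ℝ U = projI ℝ U' := hinj (by
    beta_reduce
    rw [hb, glue_proj, ← hb, hII, glue_proj]; exact hI)
  rw [← glue_proj ℝ U, ← glue_proj ℝ U', this, ← hb, hII]

/-! ### Global uniqueness of the steady state -/

lemma isSteadySolution_of_const {f : StateVec r m → StateVec r m}
    {B₂₂ : StateVec r m → Matrix (Fin m) (Fin m) ℝ}
    {U₀ : StateVec r m} {U₁ : Fin m → ℝ} (hdata : partII U₀ = U₁) {U : ℝ → StateVec r m}
    (hU : ∀ x ∈ Icc (0 : ℝ) 1, U x = U₀) : IsSteadySolution f B₂₂ U₀ U₁ U := by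
  have hloc : ∀ x ∈ Ioo (0 : ℝ) 1, U =ᶠ[𝓝 x] fun _ => U₀ := fun x hx => by
    filter_upwards [isOpen_Ioo.mem_nhds hx] with y hy using hU y (Ioo_subset_Icc_self hy)
  refine ⟨continuousOn_const.congr hU, fun x hx => ?_, fun x hx => ⟨0, ?_, ?_⟩,
    hU 0 (by simp), ?_⟩
  · exact ((differentiableAt_const U₀).congr_of_eventuallyEq (hloc x hx)).differentiableWithinAt
  · exact (hasDerivAt_const x (f U₀)).congr_of_eventuallyEq ((hloc x hx).fun_comp f)
  · refine (hasDerivAt_const x (0 : StateVec r m)).congr_of_eventuallyEq ?_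
    filter_upwards [isOpen_Ioo.mem_nhds hx] with y hy
    rw [(hloc y hy).deriv_eq, deriv_const, Matrix.mulVec_zero]
  · rw [hU 1 (by simp), hdata]

/-- With constant data the only steady state is constant. If `c` denotes the constant total flux
`f(U) - B(U) U'`, then `E = q(U) - dη(U) (f(U) - c)` satisfies `E' = -d²η(U) (U', B(U) U') ≤ 0`,
while `U(0) = U(1)` by injectivity of `(f_I, U_II)`; hence `E' = 0` and `U_II' = 0`. -/
lemma IsSteadySolution.eq_const {f : StateVec r m → StateVec r m}
    {B₂₂ : StateVec r m → Matrix (Fin m) (Fin m) ℝ} (h0 : H0 f B₂₂) (h1 : H1 B₂₂) (h2 : H2 f)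
    (hent : HasConvexEntropy f B₂₂) {U₀ : StateVec r m} {U₁ : Fin m → ℝ}
    (hdata : partII U₀ = U₁) {U : ℝ → StateVec r m} (hU : IsSteadySolution f B₂₂ U₀ U₁ U) :
    ∀ x ∈ Icc (0 : ℝ) 1, U x = U₀ := by
  have hinj := mixedMap_injective h0 h1 h2 hent
  obtain ⟨η, q, hη, hq, hall⟩ := hent
  have hUd : ∀ x ∈ Ioo (0 : ℝ) 1, HasDerivAt U (deriv U x) x := fun x hx =>
    ((hU.differentiableOn x hx).differentiableAt (isOpen_Ioo.mem_nhds hx)).hasDerivAt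
  -- the total flux is constant
  obtain ⟨c, hc⟩ : ∃ c, ∀ x ∈ Ioo (0 : ℝ) 1, f (U x) - visc B₂₂ (U x) *ᵥ deriv U x = c := by
    refine isOpen_Ioo.exists_is_const_of_deriv_eq_zero isPreconnected_Ioo
      (fun x hx => ?_) fun x hx => ?_
    · obtain ⟨d, hd1, hd2⟩ := hU.eqn x hx
      exact (hd1.sub hd2).differentiableAt.differentiableWithinAt
    · obtain ⟨d, hd1, hd2⟩ := hU.eqn x hx
      have := (hd1.sub hd2).deriv
      rw [sub_self] at this
      exact this
  have hfc : ContinuousOn (fun x => projI ℝ (f (U x))) (Icc 0 1) :=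
    (projI ℝ).continuous.comp_continuousOn (h0.1.continuous.comp_continuousOn hU.continuousOn)
  have hcI : ∀ x ∈ Icc (0 : ℝ) 1, projI ℝ (f (U x)) = projI ℝ c := by
    have hIoo : EqOn (fun x => projI ℝ (f (U x))) (fun _ => projI ℝ c) (Ioo 0 1) := fun x hx => by
      have := congrArg (projI ℝ) (hc x hx)
      rw [visc_mulVec, map_sub, projI_glue, sub_zero] at this
      exact this
    have hcl := hIoo.of_subset_closure hfc continuousOn_const Ioo_subset_Icc_self
      (by rw [closure_Ioo zero_ne_one])
    exact fun x hx => hcl hx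
  have hfI : ∀ x ∈ Icc (0 : ℝ) 1, projI ℝ (f (U x)) = projI ℝ (f U₀) := fun x hx => by
    rw [hcI x hx, ← hcI 0 (by simp), hU.left]
  have hmixed : ∀ x ∈ Icc (0 : ℝ) 1, partII (U x) = partII U₀ → U x = U₀ := fun x hx h =>
    hinj (by rw [mixedMap, mixedMap, h, partI_eq, partI_eq, hfI x hx])
  have h10 : U 1 = U₀ := hmixed 1 (by simp) (by rw [hU.right, hdata])
  -- the entropy balance
  set E : ℝ → ℝ := fun x => q (U x) - fderiv ℝ η (U x) (f (U x) - c) with hE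
  have hEc : ContinuousOn E (Icc 0 1) := by
    have h1 := hq.continuous.comp_continuousOn hU.continuousOn
    have h2 := (hη.continuous_fderiv two_ne_zero).comp_continuousOn hU.continuousOn
    have h3 := h0.1.continuous.comp_continuousOn hU.continuousOn
    exact h1.sub (h2.clm_apply (h3.sub continuousOn_const))
  have hEd : ∀ x ∈ Ioo (0 : ℝ) 1, HasDerivAt E
      (-fderiv ℝ (fderiv ℝ η) (U x) (deriv U x) (visc B₂₂ (U x) *ᵥ deriv U x)) x := by
    intro x hx
    have h1 := (hq.differentiable one_ne_zero (U x)).hasFDerivAt.comp_hasDerivAt x (hUd x hx)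
    have h2 := ((hη.fderiv_right (m := 1) (by norm_num)).differentiable one_ne_zero
      (U x)).hasFDerivAt.comp_hasDerivAt x (hUd x hx)
    have h3 := ((h0.1.differentiable (by simp) (U x)).hasFDerivAt.comp_hasDerivAt x
      (hUd x hx)).sub_const c
    refine (h1.sub (h2.clm_apply h3)).congr_deriv ?_
    rw [← (hall (U x)).2.1, ← hc x hx]
    simp [ContinuousLinearMap.comp_apply]
  have hanti : AntitoneOn E (Icc 0 1) := by
    refine antitoneOn_of_deriv_nonpos (convex_Icc 0 1) hEc (fun x hx => ?_) fun x hx => ?_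
    · rw [interior_Icc] at hx
      exact (hEd x hx).differentiableAt.differentiableWithinAt
    · rw [interior_Icc] at hx
      rw [(hEd x hx).deriv]
      exact neg_nonpos.mpr (hess_visc_pos h1 (hall (U x)).2.2.1 (hall (U x)).2.2.2 _).1
  have hE01 : E 0 = E 1 := by simp only [hE, hU.left, h10]
  have hEconst : ∀ x ∈ Icc (0 : ℝ) 1, E x = E 0 := fun x hx =>
    le_antisymm (hanti (by simp) hx hx.1) (hE01 ▸ hanti hx (by simp) hx.2)
  have hII' : ∀ x ∈ Ioo (0 : ℝ) 1, projII ℝ (deriv U x) = 0 := fun x hx => by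
    have h3 : HasDerivAt E 0 x := (hasDerivAt_const x (E 0)).congr_of_eventuallyEq (by
      filter_upwards [isOpen_Ioo.mem_nhds hx] with y hy using hEconst y (Ioo_subset_Icc_self hy))
    have h4 := (hEd x hx).unique h3
    exact (hess_visc_pos h1 (hall (U x)).2.2.1 (hall (U x)).2.2.2 _).2 (neg_eq_zero.mp h4)
  have hIIconst : ∀ x ∈ Icc (0 : ℝ) 1, projII ℝ (U x) = projII ℝ (U 0) := by
    have hder : ∀ x ∈ Ioo (0 : ℝ) 1, HasDerivAt (fun x => projII ℝ (U x)) 0 x := fun x hx => by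
      rw [← hII' x hx]
      exact (projII ℝ).hasFDerivAt.comp_hasDerivAt x (hUd x hx)
    obtain ⟨k, hk⟩ := isOpen_Ioo.exists_is_const_of_deriv_eq_zero isPreconnected_Ioo
      (fun x hx => (hder x hx).differentiableAt.differentiableWithinAt)
      (fun x hx => (hder x hx).deriv)
    have hcl := Set.EqOn.of_subset_closure (g := fun _ => k) (fun x hx => hk x hx)
      ((projII ℝ).continuous.comp_continuousOn hU.continuousOn)
      continuousOn_const (Ioo_subset_Icc_self (a := (0 : ℝ)) (b := 1))
      (by rw [closure_Ioo zero_ne_one])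
    intro x hx
    exact (hcl hx).trans (hcl (by simp)).symm
  exact fun x hx => hmixed x hx (by rw [partII_eq, hIIconst x hx, hU.left, partII_eq])

/-! ### Linear differential equations and the Volterra operator -/

section Extend

variable {E : Type*} [NormedAddCommGroup E]

/-- A curve on `[0,1]`, extended to `ℝ` by its end values. -/
noncomputable def extend (h : C(Icc (0 : ℝ) 1, E)) : ℝ → E :=
  IccExtend (zero_le_one' ℝ) h

lemma continuous_extend (h : C(Icc (0 : ℝ) 1, E)) : Continuous (extend h) :=
  h.continuous.Icc_extend'

lemma extend_coe (h : C(Icc (0 : ℝ) 1, E)) (x : Icc (0 : ℝ) 1) : extend h x = h x :=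
  IccExtend_val _ _ x

lemma extend_of_mem (h : C(Icc (0 : ℝ) 1, E)) {x : ℝ} (hx : x ∈ Icc (0 : ℝ) 1) :
    extend h x = h ⟨x, hx⟩ := IccExtend_of_mem _ _ hx

end Extend

section LinearODE

variable {E : Type*} [NormedAddCommGroup E] [NormedSpace ℝ E]

lemma hasDerivWithinAt_Ici_of_Icc {f : ℝ → E} {f' : E} {t : ℝ} (ht : t ∈ Ico (0 : ℝ) 1)
    (h : HasDerivWithinAt f f' (Icc 0 1) t) : HasDerivWithinAt f f' (Ici t) t :=
  h.mono_of_mem_nhdsWithin (Icc_mem_nhdsGE_of_mem ht)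

lemma eqOn_of_linear_ode (M : E →L[ℝ] E) {g Y Z : ℝ → E}
    (hY : ∀ x ∈ Icc (0 : ℝ) 1, HasDerivWithinAt Y (M (Y x) + g x) (Icc 0 1) x)
    (hZ : ∀ x ∈ Icc (0 : ℝ) 1, HasDerivWithinAt Z (M (Z x) + g x) (Icc 0 1) x)
    (h0 : Y 0 = Z 0) : EqOn Y Z (Icc 0 1) := by
  refine ODE_solution_unique_of_mem_Icc_right (v := fun t y => M y + g t) (s := fun _ => univ)
    (K := ‖M‖₊) (fun t _ => ?_) (fun x hx => (hY x hx).continuousWithinAt)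
    (fun t ht => hasDerivWithinAt_Ici_of_Icc ht (hY t (Ico_subset_Icc_self ht)))
    (fun _ _ => mem_univ _) (fun x hx => (hZ x hx).continuousWithinAt)
    (fun t ht => hasDerivWithinAt_Ici_of_Icc ht (hZ t (Ico_subset_Icc_self ht)))
    (fun _ _ => mem_univ _) h0
  refine LipschitzOnWith.of_dist_le_mul fun x _ y _ => ?_
  rw [dist_add_right]
  exact M.lipschitz.dist_le_mul x y

/-- The Volterra operator `h ↦ (x ↦ ∫₀ˣ h)` on `C([0,1]; E)`. -/
noncomputable def volterra : C(Icc (0 : ℝ) 1, E) →L[ℝ] C(Icc (0 : ℝ) 1, E) :=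
  LinearMap.mkContinuous
    { toFun := fun h => ⟨fun x => ∫ s in (0 : ℝ)..x, extend h s,
        (intervalIntegral.continuous_primitive
          (fun a b => (continuous_extend h).intervalIntegrable a b) 0).comp continuous_subtype_val⟩
      map_add' := fun h k => by
        ext x
        exact intervalIntegral.integral_add ((continuous_extend h).intervalIntegrable _ _)
          ((continuous_extend k).intervalIntegrable _ _)
      map_smul' := fun c h => by
        ext x
        exact intervalIntegral.integral_smul c (extend h) } 1 fun h => by
    rw [one_mul]
    refine (ContinuousMap.norm_le _ (norm_nonneg h)).mpr fun x => ?_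
    have : ‖∫ s in (0 : ℝ)..x, extend h s‖ ≤ ‖h‖ * |(x : ℝ) - 0| :=
      intervalIntegral.norm_integral_le_of_norm_le_const fun s _ => h.norm_coe_le_norm _
    refine this.trans (mul_le_of_le_one_right (norm_nonneg h) ?_)
    rw [sub_zero, abs_of_nonneg x.2.1]; exact x.2.2

lemma volterra_apply (h : C(Icc (0 : ℝ) 1, E)) (x : Icc (0 : ℝ) 1) :
    volterra h x = ∫ s in (0 : ℝ)..x, extend h s := rfl

/-- Duhamel's solution `∫₀ˣ exp((x - s) M) g(s) ds` of `Y' = M Y + g`, `Y(0) = 0`. -/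
noncomputable def duhamel (M : E →L[ℝ] E) (g : ℝ → E) (x : ℝ) : E :=
  NormedSpace.exp (x • M) (∫ s in (0 : ℝ)..x, NormedSpace.exp ((-s) • M) (g s))

@[simp] lemma duhamel_zero (M : E →L[ℝ] E) (g : ℝ → E) : duhamel M g 0 = 0 := by
  simp [duhamel]

variable [CompleteSpace E]

lemma continuous_exp_smul (M : E →L[ℝ] E) : Continuous fun x : ℝ => NormedSpace.exp (x • M) :=
  continuous_iff_continuousAt.mpr fun x => (hasDerivAt_exp_smul_const M x).continuousAt

lemma hasDerivAt_duhamel (M : E →L[ℝ] E) {g : ℝ → E} (hg : Continuous g) (x : ℝ) :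
    HasDerivAt (duhamel M g) (M (duhamel M g x) + g x) x := by
  have hc : Continuous fun s : ℝ => NormedSpace.exp ((-s) • M) (g s) :=
    ((continuous_exp_smul M).comp continuous_neg).clm_apply hg
  have h1 := hasDerivAt_exp_smul_const' M x
  have h2 := hc.integral_hasStrictDerivAt 0 x |>.hasDerivAt
  have h3 : NormedSpace.exp (x • M) (NormedSpace.exp ((-x) • M) (g x)) = g x := by
    let _ := NormedAlgebra.restrictScalars ℚ ℝ (E →L[ℝ] E)
    rw [← mul_apply_eq_comp, neg_smul, ← NormedSpace.exp_add_of_commute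
      (Commute.neg_right (Commute.refl _)), add_neg_cancel, NormedSpace.exp_zero]
    rfl
  refine (h1.clm_apply h2).congr_deriv ?_
  rw [h3, mul_apply_eq_comp]
  rfl

lemma exists_bound_duhamel (M : E →L[ℝ] E) :
    ∃ K, 0 ≤ K ∧ ∀ (g : ℝ → E) (C : ℝ), (∀ x ∈ Icc (0 : ℝ) 1, ‖g x‖ ≤ C) →
      ∀ x ∈ Icc (0 : ℝ) 1, ‖duhamel M g x‖ ≤ K * C := by
  obtain ⟨K₁, hK₁⟩ := isCompact_Icc.exists_bound_of_continuousOn (s := Icc (0 : ℝ) 1)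
    (continuous_exp_smul M).continuousOn
  obtain ⟨K₂, hK₂⟩ := isCompact_Icc.exists_bound_of_continuousOn (s := Icc (0 : ℝ) 1)
    ((continuous_exp_smul M).comp continuous_neg).continuousOn
  have h01 : (0 : ℝ) ∈ Icc (0 : ℝ) 1 := by simp
  have hK₁0 : 0 ≤ K₁ := (norm_nonneg _).trans (hK₁ 0 h01)
  have hK₂0 : 0 ≤ K₂ := (norm_nonneg _).trans (hK₂ 0 h01)
  refine ⟨K₁ * K₂, mul_nonneg hK₁0 hK₂0, fun g C hg x hx => ?_⟩
  have hC : 0 ≤ C := (norm_nonneg _).trans (hg 0 h01)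
  have hint : ‖∫ s in (0 : ℝ)..x, NormedSpace.exp ((-s) • M) (g s)‖ ≤ K₂ * C * |x - 0| := by
    refine intervalIntegral.norm_integral_le_of_norm_le_const fun s hs => ?_
    rw [uIoc_of_le hx.1] at hs
    have hs' : s ∈ Icc (0 : ℝ) 1 := ⟨hs.1.le, hs.2.trans hx.2⟩
    exact (ContinuousLinearMap.le_opNorm _ _).trans
      (mul_le_mul (hK₂ s hs') (hg s hs') (norm_nonneg _) hK₂0)
  have hint' : ‖∫ s in (0 : ℝ)..x, NormedSpace.exp ((-s) • M) (g s)‖ ≤ K₂ * C := by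
    refine hint.trans (mul_le_of_le_one_right (mul_nonneg hK₂0 hC) ?_)
    rw [sub_zero, abs_of_nonneg hx.1]; exact hx.2
  calc ‖duhamel M g x‖ ≤ ‖NormedSpace.exp (x • M)‖ *
        ‖∫ s in (0 : ℝ)..x, NormedSpace.exp ((-s) • M) (g s)‖ :=
        ContinuousLinearMap.le_opNorm _ _
    _ ≤ K₁ * (K₂ * C) := mul_le_mul (hK₁ x hx) hint' (norm_nonneg _) hK₁0
    _ = K₁ * K₂ * C := by ring

/-- `v = v₀ + ∫ g` in integrated form gives `v' = g` on `[0,1]`. -/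
lemma hasDerivWithinAt_extend_of_eq_volterra {v g : C(Icc (0 : ℝ) 1, E)} {v₀ : E}
    (h : ∀ x, v x = v₀ + volterra g x) (x : ℝ) (hx : x ∈ Icc (0 : ℝ) 1) :
    HasDerivWithinAt (extend v) (extend g x) (Icc 0 1) x := by
  have h1 := (((continuous_extend g).integral_hasStrictDerivAt 0 x).hasDerivAt.const_add
    v₀).hasDerivWithinAt (s := Icc (0 : ℝ) 1)
  have heq : ∀ y ∈ Icc (0 : ℝ) 1, extend v y = v₀ + ∫ s in (0 : ℝ)..y, extend g s :=
    fun y hy => by rw [extend_of_mem v hy, h, volterra_apply]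
  exact h1.congr heq (heq x hx)

/-- `1 - (Volterra operator) ∘ M` is invertible: Duhamel's formula gives the inverse. -/
lemma bijective_sub_volterra (M : E →L[ℝ] E) :
    Function.Bijective (ContinuousLinearMap.id ℝ C(Icc (0 : ℝ) 1, E) -
      volterra.comp (M.compLeftContinuous ℝ (Icc (0 : ℝ) 1))) := by
  constructor
  · rw [injective_iff_map_eq_zero]
    intro h hh
    have h1 : h = volterra (M.compLeftContinuous ℝ (Icc (0 : ℝ) 1) h) := sub_eq_zero.mp hh
    have hder := hasDerivWithinAt_extend_of_eq_volterra (v := h) (v₀ := 0)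
      (g := M.compLeftContinuous ℝ (Icc (0 : ℝ) 1) h) (fun x => by rw [zero_add, ← h1])
    have h0 : extend h 0 = 0 := by
      rw [extend_of_mem h (by simp), h1, volterra_apply]
      exact intervalIntegral.integral_same
    have hz := eqOn_of_linear_ode M (g := 0) (Y := extend h) (Z := 0) (fun x hx => by
      refine (hder x hx).congr_deriv ?_
      simp only [Pi.zero_apply, add_zero]
      rfl) (fun x hx => by simpa using! hasDerivWithinAt_const x (Icc (0 : ℝ) 1) (0 : E)) h0
    ext x
    rw [← extend_coe h x]
    exact hz x.2
  · intro b
    have hgc : Continuous fun x => M (extend b x) := M.continuous.comp (continuous_extend b)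
    set z := duhamel M fun x => M (extend b x) with hz
    have hzd := hasDerivAt_duhamel M hgc
    have hzc : Continuous z := continuous_iff_continuousAt.mpr fun x => (hzd x).continuousAt
    set zC : C(Icc (0 : ℝ) 1, E) := ⟨fun x => z x, hzc.comp continuous_subtype_val⟩ with hzC
    refine ⟨b + zC, ?_⟩
    rw [sub_apply, sub_eq_iff_eq_add, ContinuousLinearMap.id_apply]
    congr 1
    ext x
    have hint : ∫ s in (0 : ℝ)..x, (M (z s) + M (extend b s)) = z x - z 0 :=
      intervalIntegral.integral_eq_sub_of_hasDerivAt (fun s _ => hzd s)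
        (((M.continuous.comp hzc).add hgc).intervalIntegrable _ _)
    rw [hz, duhamel_zero, sub_zero, ← hz] at hint
    change z x = ∫ s in (0 : ℝ)..x, extend (M.compLeftContinuous ℝ (Icc (0 : ℝ) 1) (b + zC)) s
    rw [← hint]
    refine intervalIntegral.integral_congr fun s hs => ?_
    rw [uIcc_of_le x.2.1] at hs
    have hs' : s ∈ Icc (0 : ℝ) 1 := ⟨hs.1, hs.2.trans x.2.2⟩
    rw [extend_of_mem _ hs', extend_of_mem _ hs', ← map_add, add_comm]
    rfl

end LinearODE

/-! ### Differentiability of the flow near an equilibrium with respect to a parameter -/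

section Parameter

variable {E P : Type*} [NormedAddCommGroup E] [NormedAddCommGroup P]

lemma eventually_forall_curve {v₀ : E} {Q : E × P → Prop}
    (hQ : ∀ᶠ p in 𝓝 (v₀, (0 : P)), Q p) :
    ∀ᶠ p : P × C(Icc (0 : ℝ) 1, E) in 𝓝 (0, ContinuousMap.const _ v₀),
      ∀ x, Q (p.2 x, p.1) := by
  obtain ⟨δ, hδ, hball⟩ := Metric.eventually_nhds_iff.mp hQ
  refine Metric.eventually_nhds_iff.mpr ⟨δ, hδ, fun p hp x => hball ?_⟩
  rw [Prod.dist_eq, max_lt_iff] at hp ⊢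
  exact ⟨(ContinuousMap.dist_apply_le_dist (f := p.2)
    (g := ContinuousMap.const _ v₀) x).trans_lt hp.2, hp.1⟩

open Classical in
/-- The superposition operator `(c, v) ↦ (x ↦ X(v(x), c))`; it takes the value `0` where that
function fails to be continuous. -/
noncomputable def superposition (X : E × P → E) (p : P × C(Icc (0 : ℝ) 1, E)) :
    C(Icc (0 : ℝ) 1, E) :=
  if h : Continuous fun x => X (p.2 x, p.1) then ⟨_, h⟩ else 0

lemma superposition_apply_eventually {X : E × P → E} {v₀ : E}
    (hXc : ∀ᶠ p in 𝓝 (v₀, (0 : P)), ContinuousAt X p) :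
    ∀ᶠ p : P × C(Icc (0 : ℝ) 1, E) in 𝓝 (0, ContinuousMap.const _ v₀),
      ∀ x, superposition X p x = X (p.2 x, p.1) := by
  filter_upwards [eventually_forall_curve hXc] with p hp x
  have h : Continuous fun x => X (p.2 x, p.1) := continuous_iff_continuousAt.mpr fun x =>
    ContinuousAt.comp (g := X) (f := fun x => (p.2 x, p.1)) (hp x) (by fun_prop)
  rw [superposition, dif_pos h]; rfl

variable [NormedSpace ℝ E] [NormedSpace ℝ P]

/-- The linear superposition operator `(c, h) ↦ (x ↦ X'(h(x), c))`. -/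
noncomputable def superpositionDeriv (X' : E × P →L[ℝ] E) :
    P × C(Icc (0 : ℝ) 1, E) →L[ℝ] C(Icc (0 : ℝ) 1, E) :=
  ((X'.comp (ContinuousLinearMap.inl ℝ E P)).compLeftContinuous ℝ (Icc (0 : ℝ) 1)).comp
      (ContinuousLinearMap.snd ℝ P C(Icc (0 : ℝ) 1, E)) +
    (ContinuousLinearMap.const ℝ (Icc (0 : ℝ) 1)).comp
      ((X'.comp (ContinuousLinearMap.inr ℝ E P)).comp
        (ContinuousLinearMap.fst ℝ P C(Icc (0 : ℝ) 1, E)))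

lemma superpositionDeriv_apply (X' : E × P →L[ℝ] E) (p : P × C(Icc (0 : ℝ) 1, E))
    (x : Icc (0 : ℝ) 1) : superpositionDeriv X' p x = X' (p.2 x, p.1) := by
  have : X' (p.2 x, p.1) = X' (p.2 x, 0) + X' (0, p.1) := by rw [← map_add]; simp
  rw [this]; rfl

/-- At a constant curve the superposition operator is strictly differentiable, because the strict
differentiability estimate of `X` at the constant holds uniformly along nearby curves. -/
lemma hasStrictFDerivAt_superposition {X : E × P → E} {X' : E × P →L[ℝ] E} {v₀ : E}
    (hX : HasStrictFDerivAt X X' (v₀, 0))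
    (hXc : ∀ᶠ p in 𝓝 (v₀, (0 : P)), ContinuousAt X p) :
    HasStrictFDerivAt (superposition X) (superpositionDeriv X')
      (0, ContinuousMap.const (Icc (0 : ℝ) 1) v₀) := by
  refine .of_isLittleO (Asymptotics.isLittleO_iff.mpr fun ε hε => ?_)
  have h1 := hX.isLittleO.def hε
  rw [nhds_prod_eq, Filter.Eventually, Filter.mem_prod_same_iff] at h1
  obtain ⟨s, hs, h1⟩ := h1
  have hc := superposition_apply_eventually hXc
  have hd := eventually_forall_curve (Q := s) hs
  rw [nhds_prod_eq]
  filter_upwards [(hc.and hd).prod_mk (hc.and hd)] with ⟨p, p'⟩ ⟨⟨hp, hps⟩, hp', hps'⟩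
  refine (ContinuousMap.norm_le _ (by positivity)).mpr fun x => ?_
  have h2 : ‖_‖ ≤ _ := h1 (mk_mem_prod (hps x) (hps' x))
  simp only [ContinuousMap.sub_apply, hp, hp', superpositionDeriv_apply]
  refine h2.trans (mul_le_mul_of_nonneg_left ?_ hε.le)
  rw [Prod.norm_def, Prod.norm_def, max_comm]
  exact max_le_max le_rfl ((p - p').2.norm_coe_le_norm x)

variable [CompleteSpace E] [CompleteSpace P]

/-- Near an equilibrium `v₀` of `v' = X(v, 0)`, the initial value problem `v' = X(v, c)`,
`v(0) = v₀` is solvable on `[0,1]` for small `c`, and the endpoint `v(1)` is differentiable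
in `c` at `0`; its derivative is the endpoint of the linearized problem. This is the implicit
function theorem for `v - v₀ - ∫ X(v, c) = 0` in `C([0,1]; E)`. -/
theorem exists_parameter_flow {X : E × P → E} {X' : E × P →L[ℝ] E} {v₀ : E}
    (hX : HasStrictFDerivAt X X' (v₀, 0)) (hX0 : X (v₀, 0) = 0)
    (hXc : ∀ᶠ p in 𝓝 (v₀, (0 : P)), ContinuousAt X p) {S : Set E} (hS : S ∈ 𝓝 v₀) :
    ∃ (V : P → ℝ → E) (Φ : P →L[ℝ] E),
      (∀ᶠ c in 𝓝 (0 : P), V c 0 = v₀ ∧ ∀ x ∈ Icc (0 : ℝ) 1, V c x ∈ S ∧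
        HasDerivWithinAt (V c) (X (V c x, c)) (Icc 0 1) x) ∧
      HasFDerivAt (fun c => V c 1) Φ 0 ∧
      ∀ c, ∃ Y : ℝ → E, Y 0 = 0 ∧ Y 1 = Φ c ∧
        ∀ x ∈ Icc (0 : ℝ) 1, HasDerivWithinAt Y (X' (Y x, c)) (Icc 0 1) x := by
  set u : P × C(Icc (0 : ℝ) 1, E) := (0, ContinuousMap.const _ v₀) with hu
  set F : P × C(Icc (0 : ℝ) 1, E) → C(Icc (0 : ℝ) 1, E) := fun p =>
    p.2 - ContinuousMap.const _ v₀ - volterra (superposition X p) with hF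
  set F' : P × C(Icc (0 : ℝ) 1, E) →L[ℝ] C(Icc (0 : ℝ) 1, E) :=
    ContinuousLinearMap.snd ℝ _ _ - volterra.comp (superpositionDeriv X') with hF'
  have hFd : HasStrictFDerivAt F F' u :=
    (hasStrictFDerivAt_snd.sub_const _).sub
      (volterra.hasStrictFDerivAt.comp u (hasStrictFDerivAt_superposition hX hXc))
  set M := X'.comp (ContinuousLinearMap.inl ℝ E P) with hM
  have hF2 : F'.comp (ContinuousLinearMap.inr ℝ P C(Icc (0 : ℝ) 1, E)) =
      ContinuousLinearMap.id ℝ _ -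
        volterra.comp (M.compLeftContinuous ℝ (Icc (0 : ℝ) 1)) := by
    ext1 h
    have : superpositionDeriv X' (0, h) = M.compLeftContinuous ℝ (Icc (0 : ℝ) 1) h := by
      ext x; rw [superpositionDeriv_apply]; rfl
    simp [hF', this]
  have hbij := bijective_sub_volterra M
  rw [← hF2] at hbij
  have hinv : (F'.comp (ContinuousLinearMap.inr ℝ P C(Icc (0 : ℝ) 1, E))).IsInvertible :=
    ⟨ContinuousLinearEquiv.ofBijective _ (LinearMap.ker_eq_bot.mpr hbij.1)
      (LinearMap.range_eq_top.mpr hbij.2), ContinuousLinearEquiv.coe_ofBijective _ _ _⟩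
  set ψ := hFd.implicitFunctionOfProdDomain hinv with hψ
  have hψd := hFd.hasStrictFDerivAt_implicitFunctionOfProdDomain hinv
  have hψe := hFd.eventually_apply_implicitFunctionOfProdDomain hinv
  have hψt := hFd.tendsto_implicitFunctionOfProdDomain hinv
  set D := -(F'.comp (ContinuousLinearMap.inr ℝ P C(Icc (0 : ℝ) 1, E))).inverse.comp
    (F'.comp (ContinuousLinearMap.inl ℝ P C(Icc (0 : ℝ) 1, E))) with hD
  have hsup0 : superposition X u = 0 := by
    ext x
    rw [(superposition_apply_eventually hXc).self_of_nhds x]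
    exact hX0
  have hFu : F u = 0 := by
    change u.2 - ContinuousMap.const _ v₀ - volterra (superposition X u) = 0
    rw [hsup0, map_zero, hu, sub_self, sub_zero]
  have h1mem : (1 : ℝ) ∈ Icc (0 : ℝ) 1 := by simp
  have h0mem : (0 : ℝ) ∈ Icc (0 : ℝ) 1 := by simp
  have hvol0 : ∀ h : C(Icc (0 : ℝ) 1, E), volterra h ⟨0, h0mem⟩ = 0 := fun h =>
    intervalIntegral.integral_same
  refine ⟨fun c => extend (ψ c), (ContinuousMap.evalCLM ℝ ⟨1, h1mem⟩).comp D, ?_, ?_, ?_⟩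
  · have htend : Filter.Tendsto (fun c => (c, ψ c)) (𝓝 (0 : P)) (𝓝 u) :=
      (Filter.tendsto_id.prodMk_nhds hψt)
    have hSe : ∀ᶠ p in 𝓝 (v₀, (0 : P)), p.1 ∈ S := continuousAt_fst.eventually_mem hS
    filter_upwards [hψe, htend.eventually (superposition_apply_eventually hXc),
      htend.eventually (eventually_forall_curve hSe)] with c h1 h2 h3
    rw [hFu] at h1
    have h4 : ∀ x, ψ c x = v₀ + volterra (superposition X (c, ψ c)) x := fun x => by
      have := congrArg (fun k : C(Icc (0 : ℝ) 1, E) => k x) h1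
      simp only [hF, ContinuousMap.sub_apply, ContinuousMap.const_apply,
        ContinuousMap.zero_apply] at this
      rw [sub_sub, sub_eq_zero] at this
      exact this
    refine ⟨?_, fun x hx => ⟨?_, ?_⟩⟩
    · rw [extend_of_mem _ h0mem, h4, hvol0, add_zero]
    · rw [extend_of_mem _ hx]; exact h3 _
    · refine (hasDerivWithinAt_extend_of_eq_volterra h4 x hx).congr_deriv ?_
      rw [extend_of_mem _ hx, extend_of_mem _ hx, h2]
  · have := (ContinuousMap.evalCLM (M := E) ℝ (⟨1, h1mem⟩ : Icc (0 : ℝ) 1)).hasFDerivAt.comp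
      (0 : P) hψd.hasFDerivAt
    refine this.congr_of_eventuallyEq (Filter.Eventually.of_forall fun c => ?_)
    exact extend_of_mem _ h1mem
  · intro c
    have h1 : F' (0, D c) = - F' (c, 0) := by
      have h2 := congrArg (fun L => L (F' (c, 0))) (hinv.self_comp_inverse)
      simp only [ContinuousLinearMap.comp_apply, ContinuousLinearMap.inr_apply,
        ContinuousLinearMap.id_apply] at h2
      simp only [hD, neg_apply, ContinuousLinearMap.comp_apply, ContinuousLinearMap.inl_apply]
      rw [← h2, ← map_neg F', h2, Prod.neg_mk, neg_zero]
    have h2 : D c = volterra (superpositionDeriv X' (c, D c)) := by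
      have h3 : F' (c, D c) = 0 := by
        have : ((c, D c) : P × C(Icc (0 : ℝ) 1, E)) = (0, D c) + (c, 0) := by simp
        rw [this, map_add, h1, neg_add_cancel]
      exact sub_eq_zero.mp h3
    refine ⟨extend (D c), ?_, ?_, fun x hx => ?_⟩
    · rw [extend_of_mem _ h0mem, h2, hvol0]
    · exact extend_of_mem _ h1mem
    · refine (hasDerivWithinAt_extend_of_eq_volterra (v := D c) (v₀ := 0)
        (fun y => by rw [zero_add]; exact congrArg (fun k : C(Icc (0 : ℝ) 1, E) => k y) h2)
        x hx).congr_deriv ?_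
      rw [extend_of_mem _ hx, superpositionDeriv_apply, extend_of_mem _ hx]

end Parameter

/-! ### Two calculus facts on `[0,1]` -/

lemma hasDerivWithinAt_bilin {E F : Type*} [NormedAddCommGroup E] [NormedSpace ℝ E]
    [FiniteDimensional ℝ E] [NormedAddCommGroup F] [NormedSpace ℝ F] [FiniteDimensional ℝ F]
    (b : E →ₗ[ℝ] F →ₗ[ℝ] ℝ) {u : ℝ → E} {v : ℝ → F} {u' : E} {v' : F} {s : Set ℝ} {x : ℝ}
    (hu : HasDerivWithinAt u u' s x) (hv : HasDerivWithinAt v v' s x) :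
    HasDerivWithinAt (fun t => b (u t) (v t)) (b u' (v x) + b (u x) v') s x := by
  set B : E →L[ℝ] F →L[ℝ] ℝ := LinearMap.toContinuousLinearMap
    ((LinearMap.toContinuousLinearMap (𝕜 := ℝ) (E := F) (F' := ℝ)).toLinearMap.comp b)
  exact (B.hasFDerivAt.comp_hasDerivWithinAt x hu).clm_apply hv

/-- A function with nonnegative derivative and `g(1) ≤ g(0)` is constant. -/
lemma deriv_eq_zero_of_nonneg_of_le {g g' : ℝ → ℝ}
    (hg : ∀ x ∈ Icc (0 : ℝ) 1, HasDerivWithinAt g (g' x) (Icc 0 1) x)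
    (hpos : ∀ x ∈ Icc (0 : ℝ) 1, 0 ≤ g' x) (h10 : g 1 ≤ g 0) :
    ∀ x ∈ Icc (0 : ℝ) 1, g' x = 0 := by
  have hmono : MonotoneOn g (Icc 0 1) := by
    refine monotoneOn_of_deriv_nonneg (convex_Icc 0 1)
      (fun x hx => (hg x hx).continuousWithinAt) (fun x hx => ?_) fun x hx => ?_
    · exact ((hg x (interior_subset hx)).mono interior_subset).differentiableWithinAt
    · have hx' := interior_subset hx
      rw [((hg x hx').hasDerivAt (mem_interior_iff_mem_nhds.mp hx)).deriv]
      exact hpos x hx'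
  have hconst : ∀ x ∈ Icc (0 : ℝ) 1, g x = g 0 := fun x hx =>
    le_antisymm ((hmono hx (by simp) hx.2).trans h10) (hmono (by simp) hx hx.1)
  intro x hx
  have h1 : HasDerivWithinAt g 0 (Icc 0 1) x :=
    (hasDerivWithinAt_const x (Icc (0 : ℝ) 1) (g 0)).congr hconst (hconst x hx)
  exact ((uniqueDiffOn_Icc (zero_lt_one' ℝ)) x hx).eq_deriv _ (hg x hx) h1

/-! ### The reduced profile equation -/

/-- `B₂₂(U)` as a continuous linear operator. -/
noncomputable def viscCLM (B₂₂ : StateVec r m → Matrix (Fin m) (Fin m) ℝ) (U : StateVec r m) :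
    (Fin m → ℝ) →L[ℝ] (Fin m → ℝ) :=
  LinearMap.toContinuousLinearMap (Matrix.mulVecLin (B₂₂ U))

lemma viscCLM_apply (B₂₂ : StateVec r m → Matrix (Fin m) (Fin m) ℝ) (U : StateVec r m)
    (v : Fin m → ℝ) : viscCLM B₂₂ U v = B₂₂ U *ᵥ v := rfl

lemma contDiff_viscCLM {B₂₂ : StateVec r m → Matrix (Fin m) (Fin m) ℝ}
    (hB : ∀ i j, ContDiff ℝ ∞ fun U => B₂₂ U i j) : ContDiff ℝ ∞ (viscCLM B₂₂) := by
  refine contDiff_clm_apply_iff.mpr fun v => contDiff_pi.mpr fun i => ?_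
  simp only [viscCLM_apply, Matrix.mulVec, dotProduct]
  exact ContDiff.sum fun j _ => (hB i j).mul contDiff_const

lemma isUnit_viscCLM {B₂₂ : StateVec r m → Matrix (Fin m) (Fin m) ℝ} (h1 : H1 B₂₂)
    (U : StateVec r m) : IsUnit (viscCLM B₂₂ U) := by
  rw [ContinuousLinearMap.isUnit_iff_bijective]
  have hu := isUnit_of_dotProduct_mulVec_pos fun x hx =>
    dotProduct_mulVec_pos_of_add_transpose (h1 U) hx
  exact ⟨Matrix.mulVec_injective_of_isUnit hu, Matrix.mulVec_surjective_iff_isUnit.mpr hu⟩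

/-- The inverse of `B₂₂(U)`. -/
noncomputable def viscInv (B₂₂ : StateVec r m → Matrix (Fin m) (Fin m) ℝ) (U : StateVec r m) :
    (Fin m → ℝ) →L[ℝ] (Fin m → ℝ) := Ring.inverse (viscCLM B₂₂ U)

lemma hasStrictFDerivAt_viscInv {B₂₂ : StateVec r m → Matrix (Fin m) (Fin m) ℝ}
    (hB : ∀ i j, ContDiff ℝ ∞ fun U => B₂₂ U i j) (h1 : H1 B₂₂) (U : StateVec r m) :
    HasStrictFDerivAt (viscInv B₂₂) (fderiv ℝ (viscInv B₂₂) U) U := by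
  obtain ⟨u, hu⟩ := isUnit_viscCLM h1 U
  have h : ContDiffAt ℝ ∞ (viscInv B₂₂) U := by
    refine ContDiffAt.comp (g := Ring.inverse) (f := viscCLM B₂₂) U ?_
      (contDiff_viscCLM hB).contDiffAt
    rw [← hu]
    exact contDiffAt_ringInverse ℝ u
  exact h.hasStrictFDerivAt (by simp)

lemma mulVec_viscInv {B₂₂ : StateVec r m → Matrix (Fin m) (Fin m) ℝ} (h1 : H1 B₂₂)
    (U : StateVec r m) (v : Fin m → ℝ) : B₂₂ U *ᵥ viscInv B₂₂ U v = v := by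
  rw [← viscCLM_apply, ← mul_apply_eq_comp, viscInv,
    Ring.mul_inverse_cancel _ (isUnit_viscCLM h1 U)]
  rfl

lemma viscInv_mulVec {B₂₂ : StateVec r m → Matrix (Fin m) (Fin m) ℝ} (h1 : H1 B₂₂)
    (U : StateVec r m) (v : Fin m → ℝ) : viscInv B₂₂ U (B₂₂ U *ᵥ v) = v := by
  rw [← viscCLM_apply, ← mul_apply_eq_comp, viscInv,
    Ring.inverse_mul_cancel _ (isUnit_viscCLM h1 U)]
  rfl

/-- The state `U` with `f_I(U) = f_I(U₀)` and `U_II = v`. For `v` such that there is none, the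
value is arbitrary. -/
noncomputable def lift (f : StateVec r m → StateVec r m) (U₀ : StateVec r m) (v : Fin m → ℝ) :
    StateVec r m :=
  Function.invFun (mixedMap f) (glue ℝ (partI (f U₀), v))

/-- The right-hand side of the profile equation, as an equation `v' = X(v, C)` for `v = U_II`. -/
noncomputable def profileField (f : StateVec r m → StateVec r m)
    (B₂₂ : StateVec r m → Matrix (Fin m) (Fin m) ℝ) (U₀ : StateVec r m)
    (p : (Fin m → ℝ) × (Fin m → ℝ)) : Fin m → ℝ :=
  viscInv B₂₂ (lift f U₀ p.1)
    (projII ℝ (f (lift f U₀ p.1)) - projII ℝ (f U₀) + viscCLM B₂₂ U₀ p.2)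

section Profile

variable {f : StateVec r m → StateVec r m} {B₂₂ : StateVec r m → Matrix (Fin m) (Fin m) ℝ}
  {U₀ : StateVec r m}

lemma lift_eq (hinj : Function.Injective (mixedMap f)) {U : StateVec r m}
    (hU : partI (f U) = partI (f U₀)) : lift f U₀ (projII ℝ U) = U := by
  rw [lift, ← hU]
  exact Function.leftInverse_invFun hinj U

lemma hasStrictFDerivAt_lift (hinj : Function.Injective (mixedMap f)) {U : StateVec r m}
    (hU : partI (f U) = partI (f U₀)) {e : StateVec r m ≃L[ℝ] StateVec r m}
    (he : HasStrictFDerivAt (mixedMap f) (e : StateVec r m →L[ℝ] StateVec r m) U) :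
    HasStrictFDerivAt (lift f U₀) ((e.symm : StateVec r m →L[ℝ] StateVec r m).comp
      ((glue ℝ).comp (ContinuousLinearMap.inr ℝ _ _))) (projII ℝ U) := by
  have h1 := he.to_local_left_inverse (g := Function.invFun (mixedMap f))
    (Filter.Eventually.of_forall (Function.leftInverse_invFun hinj))
  have h2 : HasStrictFDerivAt (fun v : Fin m → ℝ => glue ℝ (partI (f U₀), v))
      ((glue ℝ).comp (ContinuousLinearMap.inr ℝ _ _)) (projII ℝ U) :=
    (glue ℝ).hasStrictFDerivAt.comp (projII ℝ U)
      ((hasStrictFDerivAt_const (partI (f U₀)) (projII ℝ U)).prodMk (hasStrictFDerivAt_id _))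
  have h3 : mixedMap f U = glue ℝ (partI (f U₀), projII ℝ U) := by rw [← hU]; rfl
  rw [h3] at h1
  exact h1.comp (projII ℝ U) h2

/-- The set of `U_II`-components of states with `f_I(U) = f_I(U₀)` is a neighbourhood of each
of its points. -/
lemma eventually_exists_lift (h0 : H0 f B₂₂) (h2 : H2 f) {U : StateVec r m}
    (hU : partI (f U) = partI (f U₀)) :
    ∀ᶠ v in 𝓝 (projII ℝ U), ∃ V, partI (f V) = partI (f U₀) ∧ projII ℝ V = v := by
  obtain ⟨e, he, -⟩ := exists_mixedMap_deriv h0.1 h2 U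
  have hr : range (mixedMap f) ∈ 𝓝 (glue ℝ (partI (f U₀), projII ℝ U)) := by
    have : mixedMap f U = glue ℝ (partI (f U₀), projII ℝ U) := by rw [← hU]; rfl
    rw [← this, ← he.map_nhds_eq_of_equiv]
    exact Filter.range_mem_map
  have hc : Continuous fun v : Fin m → ℝ => glue ℝ (partI (f U₀), v) := by fun_prop
  filter_upwards [hc.continuousAt.preimage_mem_nhds hr] with v ⟨V, hV⟩
  have hV' : mixedMap f V = glue ℝ (partI (f U₀), v) := hV
  exact ⟨V, by simpa [mixedMap] using! congrArg (projI ℝ) hV',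
    by simpa [mixedMap] using! congrArg (projII ℝ) hV'⟩

lemma exists_hasStrictFDerivAt_profileField (h0 : H0 f B₂₂) (h1 : H1 B₂₂) (h2 : H2 f)
    (hinj : Function.Injective (mixedMap f)) {U : StateVec r m}
    (hU : partI (f U) = partI (f U₀)) (C : Fin m → ℝ) :
    ∃ X' : (Fin m → ℝ) × (Fin m → ℝ) →L[ℝ] (Fin m → ℝ),
      HasStrictFDerivAt (profileField f B₂₂ U₀) X' (projII ℝ U, C) := by
  obtain ⟨e, he, -⟩ := exists_mixedMap_deriv h0.1 h2 U
  have hl : HasStrictFDerivAt (fun p : (Fin m → ℝ) × (Fin m → ℝ) => lift f U₀ p.1)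
      (((e.symm : StateVec r m →L[ℝ] StateVec r m).comp ((glue ℝ).comp
        (ContinuousLinearMap.inr ℝ _ _))).comp (ContinuousLinearMap.fst ℝ _ _))
      (projII ℝ U, C) :=
    HasStrictFDerivAt.comp (g := lift f U₀) (f := Prod.fst) (projII ℝ U, C)
      (hasStrictFDerivAt_lift hinj hU he) hasStrictFDerivAt_fst
  have hl0 := lift_eq (U₀ := U₀) hinj hU
  have hi := (hasStrictFDerivAt_viscInv h0.2 h1 (lift f U₀ (projII ℝ U))).comp
    (projII ℝ U, C) hl
  have hf := ((projII ℝ).hasStrictFDerivAt.comp (projII ℝ U, C)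
    ((h0.1.contDiffAt.hasStrictFDerivAt (x := lift f U₀ (projII ℝ U)) (by simp)).comp
      (projII ℝ U, C) hl)).sub_const (projII ℝ (f U₀))
  have hc := (viscCLM B₂₂ U₀).hasStrictFDerivAt.comp (projII ℝ U, C)
    (hasStrictFDerivAt_snd (𝕜 := ℝ) (p := (projII ℝ U, C)))
  exact ⟨_, hi.clm_apply (hf.add hc)⟩

/-- At the equilibrium, the linearization of the profile field is
`(h, c) ↦ B₂₂⁻¹ ((A T h)_II + B₂₂ c)`, with `T h` the tangent vector satisfying `(A T h)_I = 0`
and `(T h)_II = h`. -/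
lemma hasStrictFDerivAt_profileField_equilibrium (h0 : H0 f B₂₂) (h1 : H1 B₂₂)
    (hinj : Function.Injective (mixedMap f)) {e : StateVec r m ≃L[ℝ] StateVec r m}
    (he : HasStrictFDerivAt (mixedMap f) (e : StateVec r m →L[ℝ] StateVec r m) U₀) :
    ∃ X' : (Fin m → ℝ) × (Fin m → ℝ) →L[ℝ] (Fin m → ℝ),
      HasStrictFDerivAt (profileField f B₂₂ U₀) X' (projII ℝ U₀, 0) ∧
      ∀ h c, X' (h, c) = viscInv B₂₂ U₀
        (projII ℝ (jac f U₀ *ᵥ e.symm (glue ℝ (0, h))) + B₂₂ U₀ *ᵥ c) := by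
  have hl : HasStrictFDerivAt (fun p : (Fin m → ℝ) × (Fin m → ℝ) => lift f U₀ p.1)
      (((e.symm : StateVec r m →L[ℝ] StateVec r m).comp ((glue ℝ).comp
        (ContinuousLinearMap.inr ℝ _ _))).comp (ContinuousLinearMap.fst ℝ _ _))
      (projII ℝ U₀, (0 : Fin m → ℝ)) :=
    HasStrictFDerivAt.comp (g := lift f U₀) (f := Prod.fst) (projII ℝ U₀, (0 : Fin m → ℝ))
      (hasStrictFDerivAt_lift hinj rfl he) hasStrictFDerivAt_fst
  have hl0 : lift f U₀ (projII ℝ U₀) = U₀ := lift_eq hinj rfl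
  have hi := (hasStrictFDerivAt_viscInv h0.2 h1 (lift f U₀ (projII ℝ U₀))).comp
    (projII ℝ U₀, (0 : Fin m → ℝ)) hl
  have hf := ((projII ℝ).hasStrictFDerivAt.comp (projII ℝ U₀, (0 : Fin m → ℝ))
    ((h0.1.contDiffAt.hasStrictFDerivAt (x := lift f U₀ (projII ℝ U₀)) (by simp)).comp
      (projII ℝ U₀, (0 : Fin m → ℝ)) hl)).sub_const (projII ℝ (f U₀))
  have hc := (viscCLM B₂₂ U₀).hasStrictFDerivAt.comp (projII ℝ U₀, (0 : Fin m → ℝ))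
    (hasStrictFDerivAt_snd (𝕜 := ℝ) (p := (projII ℝ U₀, (0 : Fin m → ℝ))))
  refine ⟨_, hi.clm_apply (hf.add hc), fun h c => ?_⟩
  simp only [jac_mulVec, ← viscCLM_apply]
  simp [hl0]

/-- A solution of the profile problem solves the reduced equation `v' = X(v, C)`. -/
lemma IsShootingSolution.hasDerivWithinAt (h1 : H1 B₂₂) (hinj : Function.Injective (mixedMap f))
    {C : Fin m → ℝ} {W : ℝ → StateVec r m} (hW : IsShootingSolution f B₂₂ U₀ C W)
    {x : ℝ} (hx : x ∈ Icc (0 : ℝ) 1) :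
    HasDerivWithinAt (fun y => projII ℝ (W y)) (profileField f B₂₂ U₀ (projII ℝ (W x), C))
      (Icc 0 1) x := by
  obtain ⟨d, hd, hdB⟩ := hW.ode x hx
  have : profileField f B₂₂ U₀ (projII ℝ (W x), C) = d := by
    rw [profileField]
    simp only [lift_eq hinj (hW.constraint x hx)]
    rw [viscCLM_apply, ← partII_eq, ← partII_eq, ← hdB, viscInv_mulVec h1]
  rw [this]
  exact hd

/-- Uniqueness for the profile problem: the reduced field is locally Lipschitz on the compact
range of two solutions. -/
lemma IsShootingSolution.eqOn (h0 : H0 f B₂₂) (h1 : H1 B₂₂) (h2 : H2 f)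
    (hinj : Function.Injective (mixedMap f)) {C : Fin m → ℝ} {W W' : ℝ → StateVec r m}
    (hW : IsShootingSolution f B₂₂ U₀ C W) (hW' : IsShootingSolution f B₂₂ U₀ C W') :
    EqOn W W' (Icc 0 1) := by
  set w := fun x => projII ℝ (W x) with hw
  set w' := fun x => projII ℝ (W' x) with hw'
  have hwc : ContinuousOn w (Icc 0 1) := (projII ℝ).continuous.comp_continuousOn hW.continuousOn
  have hwc' : ContinuousOn w' (Icc 0 1) :=
    (projII ℝ).continuous.comp_continuousOn hW'.continuousOn
  set K := w '' Icc 0 1 ∪ w' '' Icc 0 1 with hK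
  have hKc : IsCompact K := (isCompact_Icc.image_of_continuousOn hwc).union
    (isCompact_Icc.image_of_continuousOn hwc')
  have hlip : LocallyLipschitzOn K fun v => profileField f B₂₂ U₀ (v, C) := by
    intro v hv
    obtain ⟨U, hU, rfl⟩ : ∃ U, partI (f U) = partI (f U₀) ∧ projII ℝ U = v := by
      rcases hv with ⟨x, hx, rfl⟩ | ⟨x, hx, rfl⟩
      · exact ⟨W x, hW.constraint x hx, rfl⟩
      · exact ⟨W' x, hW'.constraint x hx, rfl⟩
    obtain ⟨X', hX'⟩ := exists_hasStrictFDerivAt_profileField h0 h1 h2 hinj hU C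
    obtain ⟨L, t, ht, hL⟩ := (hX'.comp (projII ℝ U)
      ((hasStrictFDerivAt_id (𝕜 := ℝ) (projII ℝ U)).prodMk
        (hasStrictFDerivAt_const C (projII ℝ U)))).exists_lipschitzOnWith
    exact ⟨L, t, mem_nhdsWithin_of_mem_nhds ht, hL⟩
  obtain ⟨L, hL⟩ := hlip.exists_lipschitzOnWith_of_compact hKc
  have heq : EqOn w w' (Icc 0 1) := ODE_solution_unique_of_mem_Icc_right
    (v := fun _ v => profileField f B₂₂ U₀ (v, C)) (s := fun _ => K) (K := L)
    (fun _ _ => hL) hwc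
    (fun t ht => hasDerivWithinAt_Ici_of_Icc ht
      (hW.hasDerivWithinAt h1 hinj (Ico_subset_Icc_self ht)))
    (fun t ht => Or.inl ⟨t, Ico_subset_Icc_self ht, rfl⟩) hwc'
    (fun t ht => hasDerivWithinAt_Ici_of_Icc ht
      (hW'.hasDerivWithinAt h1 hinj (Ico_subset_Icc_self ht)))
    (fun t ht => Or.inr ⟨t, Ico_subset_Icc_self ht, rfl⟩)
    (by simp only [hw, hw', hW.initial, hW'.initial])
  intro x hx
  rw [← lift_eq hinj (hW.constraint x hx), ← lift_eq hinj (hW'.constraint x hx)]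
  exact congrArg _ (heq hx)

/-- Lifting a solution of the reduced equation solves the profile problem. -/
lemma isShootingSolution_lift (h0 : H0 f B₂₂) (h1 : H1 B₂₂) (h2 : H2 f)
    (hinj : Function.Injective (mixedMap f)) {C : Fin m → ℝ} {v : ℝ → Fin m → ℝ}
    (hv0 : v 0 = projII ℝ U₀)
    (hvl : ∀ x ∈ Icc (0 : ℝ) 1, ∃ U, partI (f U) = partI (f U₀) ∧ projII ℝ U = v x)
    (hv : ∀ x ∈ Icc (0 : ℝ) 1,
      HasDerivWithinAt v (profileField f B₂₂ U₀ (v x, C)) (Icc 0 1) x) :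
    IsShootingSolution f B₂₂ U₀ C (fun x => lift f U₀ (v x)) := by
  have hlift : ∀ x ∈ Icc (0 : ℝ) 1, partI (f (lift f U₀ (v x))) = partI (f U₀) ∧
      projII ℝ (lift f U₀ (v x)) = v x := fun x hx => by
    obtain ⟨U, hU, hUv⟩ := hvl x hx
    rw [← hUv, lift_eq hinj hU]
    exact ⟨hU, rfl⟩
  refine ⟨fun x hx => ?_, ?_, fun x hx => (hlift x hx).1, fun x hx => ?_⟩
  · obtain ⟨U, hU, hUv⟩ := hvl x hx
    obtain ⟨e, he, -⟩ := exists_mixedMap_deriv h0.1 h2 U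
    have hc := (hasStrictFDerivAt_lift (U₀ := U₀) hinj hU he).continuousAt
    rw [hUv] at hc
    exact ContinuousAt.comp_continuousWithinAt (g := lift f U₀) (f := v) hc
      (hv x hx).continuousWithinAt
  · rw [hv0]; exact lift_eq hinj rfl
  · refine ⟨profileField f B₂₂ U₀ (v x, C), ?_, ?_⟩
    · exact (hv x hx).congr (fun y hy => (hlift y hy).2) (hlift x hx).2
    · rw [profileField, mulVec_viscInv h1]; rfl

end Profile

/-! ### Nondegeneracy of the constant profile -/

section BlockAlgebra

variable {𝕜 : Type*} [NontriviallyNormedField 𝕜]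

lemma dotProduct_glue (x : Fin r ⊕ Fin m → 𝕜) (p : (Fin r → 𝕜) × (Fin m → 𝕜)) :
    x ⬝ᵥ glue 𝕜 p = projI 𝕜 x ⬝ᵥ p.1 + projII 𝕜 x ⬝ᵥ p.2 := by
  simp [dotProduct, Fintype.sum_sum_type]

lemma fromBlocks_mulVec_glue (S₁₁ : Matrix (Fin r) (Fin r) 𝕜) (S₂₂ : Matrix (Fin m) (Fin m) 𝕜)
    (p : (Fin r → 𝕜) × (Fin m → 𝕜)) :
    Matrix.fromBlocks S₁₁ 0 0 S₂₂ *ᵥ glue 𝕜 p = glue 𝕜 (S₁₁ *ᵥ p.1, S₂₂ *ᵥ p.2) := by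
  ext k
  cases k <;> simp [Matrix.mulVec, dotProduct, Fintype.sum_sum_type]

end BlockAlgebra

/-- The linearized shooting problem has no nontrivial solution. With `K = S₂₂ N` symmetric, the
function `g = ½ Y·K Y + Y·S₂₂ B c` vanishes at both ends and `g' = Y'·S₂₂ B Y' ≥ 0`. -/
lemma eq_zero_of_linearized_profile {S B : Matrix (Fin m) (Fin m) ℝ}
    (hSB : ∀ x, x ≠ 0 → 0 < x ⬝ᵥ (S * B) *ᵥ x) {N : (Fin m → ℝ) →ₗ[ℝ] (Fin m → ℝ)}
    (hN : ∀ v w, w ⬝ᵥ S *ᵥ N v = v ⬝ᵥ S *ᵥ N w) {c : Fin m → ℝ} {Y Y' : ℝ → Fin m → ℝ}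
    (hY : ∀ x ∈ Icc (0 : ℝ) 1, HasDerivWithinAt Y (Y' x) (Icc 0 1) x)
    (hY' : ∀ x ∈ Icc (0 : ℝ) 1, B *ᵥ Y' x = N (Y x) + B *ᵥ c)
    (h0 : Y 0 = 0) (h1 : Y 1 = 0) : c = 0 := by
  set b : (Fin m → ℝ) →ₗ[ℝ] (Fin m → ℝ) →ₗ[ℝ] ℝ := Matrix.toLinearMap₂' ℝ S with hb
  have hbv : ∀ x y, b x y = x ⬝ᵥ S *ᵥ y := fun x y => Matrix.toLinearMap₂'_apply' S x y
  have hg : ∀ x ∈ Icc (0 : ℝ) 1, HasDerivWithinAt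
      (fun t => (1 / 2 : ℝ) * b (Y t) (N (Y t)) + b (Y t) (B *ᵥ c))
      (Y' x ⬝ᵥ (S * B) *ᵥ Y' x) (Icc 0 1) x := fun x hx => by
    have hNY : HasDerivWithinAt (fun t => N (Y t)) (N (Y' x)) (Icc 0 1) x :=
      (LinearMap.toContinuousLinearMap N).hasFDerivAt.comp_hasDerivWithinAt x (hY x hx)
    refine (((hasDerivWithinAt_bilin b (hY x hx) hNY).const_mul (1 / 2 : ℝ)).add
      (hasDerivWithinAt_bilin b (hY x hx)
        (hasDerivWithinAt_const x (Icc (0 : ℝ) 1) (B *ᵥ c)))).congr_deriv ?_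
    rw [← Matrix.mulVec_mulVec, hY' x hx, Matrix.mulVec_add, dotProduct_add, hbv, hbv, hbv,
      hN (Y' x) (Y x), map_zero]
    ring
  have hpos : ∀ x : Fin m → ℝ, 0 ≤ x ⬝ᵥ (S * B) *ᵥ x := fun x => by
    by_cases hx : x = 0
    · simp [hx]
    · exact (hSB x hx).le
  have hzero := deriv_eq_zero_of_nonneg_of_le hg (fun x _ => hpos _) (by simp [h0, h1]) 0 (by simp)
  have hY0 : Y' 0 = 0 := by
    by_contra h
    exact (hSB _ h).ne' hzero
  have h2 := hY' 0 (by simp)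
  rw [hY0, h0, map_zero, zero_add, Matrix.mulVec_zero] at h2
  by_contra h
  have := hSB c h
  rw [← Matrix.mulVec_mulVec, ← h2] at this
  simp at this

/-- The reduced equation is solvable for small `C`, and the differential of the shooting map at
`C = 0` is the endpoint map of the linearized problem, which is injective, hence invertible. -/
theorem isNondegenerate_of_const {f : StateVec r m → StateVec r m}
    {B₂₂ : StateVec r m → Matrix (Fin m) (Fin m) ℝ} (h0 : H0 f B₂₂) (h1 : H1 B₂₂) (h2 : H2 f)
    (h3 : H3 f B₂₂) (hinj : Function.Injective (mixedMap f))
    {U₀ : StateVec r m} {U₁ : Fin m → ℝ} (hdata : partII U₀ = U₁) {U : ℝ → StateVec r m}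
    (hU : ∀ x ∈ Icc (0 : ℝ) 1, U x = U₀) : IsNondegenerate f B₂₂ U₀ U₁ U := by
  have hUII : ∀ x ∈ Icc (0 : ℝ) 1,
      HasDerivWithinAt (fun y => partII (U y)) 0 (Icc 0 1) x := fun x hx =>
    (hasDerivWithinAt_const x _ (partII U₀)).congr (fun y hy => by rw [hU y hy]) (by rw [hU x hx])
  have hC : profileParam U = 0 :=
    (hUII 0 (by simp)).derivWithin (uniqueDiffOn_Icc (zero_lt_one' ℝ) 0 (by simp))
  have hsol : IsShootingSolution f B₂₂ U₀ 0 U := by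
    refine ⟨continuousOn_const.congr hU, hU 0 (by simp), fun x hx => by rw [hU x hx],
      fun x hx => ⟨0, hUII x hx, ?_⟩⟩
    rw [hU x hx, Matrix.mulVec_zero, sub_self, add_zero]
  have huniq : ∀ C W W', IsShootingSolution f B₂₂ U₀ C W → IsShootingSolution f B₂₂ U₀ C W' →
      EqOn W W' (Icc 0 1) := fun C W W' hW hW' => hW.eqOn h0 h1 h2 hinj hW'
  have hshoot : ∀ C W, IsShootingSolution f B₂₂ U₀ C W →
      shootingMap f B₂₂ U₀ U₁ C = partII (W 1) - U₁ := fun C W hW => by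
    have hex : ∃ W, IsShootingSolution f B₂₂ U₀ C W := ⟨W, hW⟩
    rw [shootingMap, dif_pos hex, huniq C _ _ hex.choose_spec hW (by simp)]
  -- the flow of the reduced equation for small parameters
  obtain ⟨e, he, hev⟩ := exists_mixedMap_deriv h0.1 h2 U₀
  obtain ⟨X', hX', hX'v⟩ := hasStrictFDerivAt_profileField_equilibrium h0 h1 hinj he
  have hl0 : lift f U₀ (projII ℝ U₀) = U₀ := lift_eq hinj rfl
  have hX0 : profileField f B₂₂ U₀ (projII ℝ U₀, 0) = 0 := by
    simp [profileField, hl0]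
  have hS := eventually_exists_lift (U₀ := U₀) (B₂₂ := B₂₂) h0 h2 rfl
  have hXc : ∀ᶠ p in 𝓝 (projII ℝ U₀, (0 : Fin m → ℝ)),
      ContinuousAt (profileField f B₂₂ U₀) p := by
    have hfst : Filter.Tendsto Prod.fst (𝓝 (projII ℝ U₀, (0 : Fin m → ℝ))) (𝓝 (projII ℝ U₀)) :=
      continuousAt_fst
    filter_upwards [hfst.eventually hS] with ⟨v, C⟩ ⟨V, hV, hVv⟩
    obtain ⟨D, hD⟩ := exists_hasStrictFDerivAt_profileField h0 h1 h2 hinj hV C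
    rw [hVv] at hD
    exact hD.continuousAt
  obtain ⟨V, Φ, hV, hVΦ, hΦ⟩ := exists_parameter_flow hX' hX0 hXc hS
  have hsolV : ∀ᶠ C in 𝓝 (0 : Fin m → ℝ),
      IsShootingSolution f B₂₂ U₀ C (fun x => lift f U₀ (V C x)) ∧
        projII ℝ (lift f U₀ (V C 1)) = V C 1 := by
    filter_upwards [hV] with C ⟨hC0, hCx⟩
    refine ⟨isShootingSolution_lift h0 h1 h2 hinj hC0 (fun x hx => (hCx x hx).1)
      (fun x hx => (hCx x hx).2), ?_⟩
    obtain ⟨W, hW, hWv⟩ := (hCx 1 (by simp)).1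
    rw [← hWv, lift_eq hinj hW]
  -- the differential is injective
  obtain ⟨S₁₁, S₂₂, -, -, hSall⟩ := h3
  obtain ⟨-, hSA, hSB⟩ := hSall U₀
  have hT : ∀ h : Fin m → ℝ, projII ℝ (e.symm (glue ℝ (0, h))) = h ∧
      jac f U₀ *ᵥ e.symm (glue ℝ (0, h)) =
        glue ℝ (0, projII ℝ (jac f U₀ *ᵥ e.symm (glue ℝ (0, h)))) := fun h => by
    have h4 := hev (e.symm (glue ℝ (0, h)))
    rw [e.apply_symm_apply] at h4
    refine ⟨(by simpa using (congrArg (projII ℝ) h4).symm), ?_⟩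
    have h5 : projI ℝ (jac f U₀ *ᵥ e.symm (glue ℝ (0, h))) = 0 := by
      simpa using (congrArg (projI ℝ) h4).symm
    conv_lhs => rw [← glue_proj ℝ (jac f U₀ *ᵥ e.symm (glue ℝ (0, h))), h5]
  set N : (Fin m → ℝ) →ₗ[ℝ] (Fin m → ℝ) :=
    (((projII ℝ : StateVec r m →L[ℝ] (Fin m → ℝ)) : StateVec r m →ₗ[ℝ] (Fin m → ℝ)).comp
      (Matrix.mulVecLin (jac f U₀))).comp
      ((((e.symm : StateVec r m →L[ℝ] StateVec r m).comp (glue ℝ)).comp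
        (ContinuousLinearMap.inr ℝ (Fin r → ℝ) (Fin m → ℝ)) :
          (Fin m → ℝ) →L[ℝ] StateVec r m) : (Fin m → ℝ) →ₗ[ℝ] StateVec r m) with hN
  have hNv : ∀ h, N h = projII ℝ (jac f U₀ *ᵥ e.symm (glue ℝ (0, h))) := fun h => rfl
  have hNform : ∀ v w, w ⬝ᵥ S₂₂ U₀ *ᵥ N v = e.symm (glue ℝ (0, w)) ⬝ᵥ
      (Matrix.fromBlocks (S₁₁ U₀) 0 0 (S₂₂ U₀) * jac f U₀) *ᵥ e.symm (glue ℝ (0, v)) :=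
    fun v w => by
      rw [← Matrix.mulVec_mulVec, (hT v).2, fromBlocks_mulVec_glue, dotProduct_glue, (hT w).1,
        ← hNv]
      simp
  have hNsymm : ∀ v w, w ⬝ᵥ S₂₂ U₀ *ᵥ N v = v ⬝ᵥ S₂₂ U₀ *ᵥ N w := fun v w => by
    rw [hNform, hNform, dotProduct_mulVec_comm hSA]
  have hΦinj : Function.Injective (Φ : (Fin m → ℝ) →ₗ[ℝ] (Fin m → ℝ)) := by
    rw [injective_iff_map_eq_zero]
    intro c hc
    obtain ⟨Y, hY0, hY1, hY⟩ := hΦ c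
    exact eq_zero_of_linearized_profile (B := B₂₂ U₀)
      (fun x hx => dotProduct_mulVec_pos_of_add_transpose hSB hx) hNsymm hY
      (fun x _ => by rw [hX'v, mulVec_viscInv h1, hNv]) hY0 (hY1.trans hc)
  refine ⟨hC ▸ hsol, huniq, ?_, ?_, (LinearEquiv.ofInjectiveEndo _ hΦinj).toContinuousLinearEquiv,
    ?_⟩
  · rw [hC]
    exact hsolV.mono fun C h => ⟨_, h.1⟩
  · rw [hC, hshoot 0 U hsol, hU 1 (by simp), hdata, sub_self]
  · rw [hC]
    have hd : HasFDerivAt (fun C => V C 1 - U₁) Φ 0 := hVΦ.sub_const U₁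
    have hd' : HasFDerivAt (shootingMap f B₂₂ U₀ U₁) Φ 0 :=
      hd.congr_of_eventuallyEq (hsolV.mono fun C h => by
        rw [hshoot C _ h.1, partII_eq, h.2])
    have hcoe : ((LinearEquiv.ofInjectiveEndo _ hΦinj).toContinuousLinearEquiv :
        (Fin m → ℝ) →L[ℝ] (Fin m → ℝ)) = Φ := ContinuousLinearMap.ext fun v => rfl
    rw [hcoe]
    exact hd'

/-! ### The resolvent equation as a first-order system -/

section RealForm

variable {ι : Type*} [Fintype ι]

/-- The real bilinear form `(x, y) ↦ Re (x* M y)` on `ℂⁿ`. -/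
noncomputable def reForm (M : Matrix ι ι ℝ) : (ι → ℂ) →ₗ[ℝ] (ι → ℂ) →ₗ[ℝ] ℝ :=
  LinearMap.mk₂ ℝ (fun x y => (star x ⬝ᵥ toC M *ᵥ y).re)
    (fun x x' y => by simp [add_dotProduct])
    (fun c x y => by simp [smul_dotProduct])
    (fun x y y' => by simp [Matrix.mulVec_add, dotProduct_add])
    (fun c x y => by simp [Matrix.mulVec_smul, dotProduct_smul])

lemma reForm_apply (M : Matrix ι ι ℝ) (x y : ι → ℂ) :
    reForm M x y = (star x ⬝ᵥ toC M *ᵥ y).re := rfl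

lemma reForm_comm {M : Matrix ι ι ℝ} (hM : M.IsSymm) (x y : ι → ℂ) :
    reForm M x y = reForm M y x := by
  simp only [reForm_apply, re_star_dotProduct_toC_mulVec]
  rw [dotProduct_mulVec_comm hM, dotProduct_mulVec_comm hM (fun i => (x i).im)]

lemma reForm_smul_self {M : Matrix ι ι ℝ} (hM : M.IsSymm) (lam : ℂ) (x : ι → ℂ) :
    reForm M x (lam • x) = lam.re * reForm M x x := by
  have hre : (fun i => ((lam • x) i).re) = lam.re • (fun i => (x i).re) -
      lam.im • (fun i => (x i).im) := by ext i; simp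
  have him : (fun i => ((lam • x) i).im) = lam.re • (fun i => (x i).im) +
      lam.im • (fun i => (x i).re) := by ext i; simp
  rw [reForm_apply, reForm_apply, re_star_dotProduct_toC_mulVec, re_star_dotProduct_toC_mulVec,
    hre, him]
  simp only [Matrix.mulVec_sub, Matrix.mulVec_add, Matrix.mulVec_smul, dotProduct_sub,
    dotProduct_add, dotProduct_smul,
    smul_eq_mul]
  rw [dotProduct_mulVec_comm hM (fun i => (x i).im) (fun i => (x i).re)]
  ring

lemma toC_mul (M N : Matrix ι ι ℝ) : toC (M * N) = toC M * toC N :=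
  Matrix.map_mul (f := Complex.ofRealHom)

lemma reForm_mulVec (M N : Matrix ι ι ℝ) (x y : ι → ℂ) :
    reForm M x (toC N *ᵥ y) = reForm (M * N) x y := by
  rw [reForm_apply, reForm_apply, Matrix.mulVec_mulVec, toC_mul]

end RealForm

lemma toC_fromBlocks (M₁ : Matrix (Fin r) (Fin r) ℝ) (M₂ : Matrix (Fin m) (Fin m) ℝ) :
    toC (Matrix.fromBlocks M₁ 0 0 M₂) = Matrix.fromBlocks (toC M₁) 0 0 (toC M₂) := by
  ext i j
  cases i <;> cases j <;> simp [toC]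

lemma reForm_fromBlocks_glue (M₁ : Matrix (Fin r) (Fin r) ℝ) (M₂ : Matrix (Fin m) (Fin m) ℝ)
    (x : Fin r ⊕ Fin m → ℂ) (p : (Fin r → ℂ) × (Fin m → ℂ)) :
    reForm (Matrix.fromBlocks M₁ 0 0 M₂) x (glue ℂ p) =
      reForm M₁ (projI ℂ x) p.1 + reForm M₂ (projII ℂ x) p.2 := by
  rw [reForm_apply, toC_fromBlocks, fromBlocks_mulVec_glue, dotProduct_glue, Complex.add_re]
  rfl

/-- The constant-coefficient data of the linearization at a state: the Jacobian `A`, the viscosity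
block `B`, and a block-diagonal symmetrizer. -/
structure SymmetrizedPair (A : Matrix (Fin r ⊕ Fin m) (Fin r ⊕ Fin m) ℝ)
    (B : Matrix (Fin m) (Fin m) ℝ) (S₁₁ : Matrix (Fin r) (Fin r) ℝ)
    (S₂₂ : Matrix (Fin m) (Fin m) ℝ) : Prop where
  symm : (Matrix.fromBlocks S₁₁ 0 0 S₂₂).IsSymm
  pos : ∀ x, x ≠ 0 → 0 < x ⬝ᵥ Matrix.fromBlocks S₁₁ 0 0 S₂₂ *ᵥ x
  symm_mul : (Matrix.fromBlocks S₁₁ 0 0 S₂₂ * A).IsSymm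
  hyperbolic_pos : ∀ x, x ≠ 0 → 0 < x ⬝ᵥ (S₁₁ * A.toBlocks₁₁) *ᵥ x
  viscous_pos : ∀ x, x ≠ 0 → 0 < x ⬝ᵥ (S₂₂ * B) *ᵥ x

section Resolvent

variable {A : Matrix (Fin r ⊕ Fin m) (Fin r ⊕ Fin m) ℝ} {B : Matrix (Fin m) (Fin m) ℝ}
  {S₁₁ : Matrix (Fin r) (Fin r) ℝ} {S₂₂ : Matrix (Fin m) (Fin m) ℝ}

lemma projI_toC_mulVec_of_projII_eq_zero (A : Matrix (Fin r ⊕ Fin m) (Fin r ⊕ Fin m) ℝ)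
    {V : Fin r ⊕ Fin m → ℂ} (hV : projII ℂ V = 0) :
    projI ℂ (toC A *ᵥ V) = toC A.toBlocks₁₁ *ᵥ projI ℂ V := by
  funext i
  conv_lhs => rw [← glue_proj ℂ V, hV]
  simp [Matrix.mulVec, dotProduct, Fintype.sum_sum_type, Matrix.toBlocks₁₁, toC]

/-- The block `A₁₁` is invertible, so a complex state is determined by `(A V)_I` and `V_II`. -/
lemma SymmetrizedPair.exists_tangent (h : SymmetrizedPair A B S₁₁ S₂₂) :
    ∃ T : ((Fin r → ℂ) × (Fin m → ℂ)) →L[ℂ] (Fin r ⊕ Fin m → ℂ),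
      (∀ p, projI ℂ (toC A *ᵥ T p) = p.1 ∧ projII ℂ (T p) = p.2) ∧
      ∀ V, T (projI ℂ (toC A *ᵥ V), projII ℂ V) = V := by
  set L : (Fin r ⊕ Fin m → ℂ) →ₗ[ℂ] (Fin r ⊕ Fin m → ℂ) :=
    ((glue ℂ : ((Fin r → ℂ) × (Fin m → ℂ)) →L[ℂ] (Fin r ⊕ Fin m → ℂ)) :
      ((Fin r → ℂ) × (Fin m → ℂ)) →ₗ[ℂ] (Fin r ⊕ Fin m → ℂ)).comp
      ((((projI ℂ : (Fin r ⊕ Fin m → ℂ) →L[ℂ] (Fin r → ℂ)) :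
        (Fin r ⊕ Fin m → ℂ) →ₗ[ℂ] (Fin r → ℂ)).comp (Matrix.mulVecLin (toC A))).prod
      ((projII ℂ : (Fin r ⊕ Fin m → ℂ) →L[ℂ] (Fin m → ℂ)) :
        (Fin r ⊕ Fin m → ℂ) →ₗ[ℂ] (Fin m → ℂ))) with hL
  have hLv : ∀ V, L V = glue ℂ (projI ℂ (toC A *ᵥ V), projII ℂ V) := fun V => rfl
  have hinj : Function.Injective L := by
    rw [injective_iff_map_eq_zero]
    intro V hV
    rw [hLv] at hV
    have hII : projII ℂ V = 0 := by simpa using congrArg (projII ℂ) hV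
    have hI : projI ℂ (toC A *ᵥ V) = 0 := by simpa using congrArg (projI ℂ) hV
    rw [projI_toC_mulVec_of_projII_eq_zero A hII] at hI
    have h0 : projI ℂ V = 0 := eq_zero_of_re_toC_eq_zero h.hyperbolic_pos (by
      rw [← reForm_apply, ← reForm_mulVec, hI, map_zero])
    rw [← glue_proj ℂ V, h0, hII]
    exact map_zero _
  set e := LinearEquiv.ofInjectiveEndo L hinj with he
  have heL : ∀ V, e V = L V := fun V => rfl
  set T := (LinearMap.toContinuousLinearMap e.symm.toLinearMap).comp
    (glue ℂ) with hT
  refine ⟨T, fun p => ?_, fun V => ?_⟩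
  · have h1 : L (T p) = glue ℂ p := e.apply_symm_apply (glue ℂ p)
    rw [hLv] at h1
    exact ⟨by simpa using congrArg (projI ℂ) h1, by simpa using congrArg (projII ℂ) h1⟩
  · change e.symm (glue ℂ (projI ℂ (toC A *ᵥ V), projII ℂ V)) = V
    rw [← hLv, ← heL, e.symm_apply_apply]

lemma SymmetrizedPair.exists_viscous_inverse (h : SymmetrizedPair A B S₁₁ S₂₂) :
    ∃ R : (Fin m → ℂ) →L[ℂ] (Fin m → ℂ),
      (∀ v, toC B *ᵥ R v = v) ∧ ∀ v, R (toC B *ᵥ v) = v := by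
  have hinj : Function.Injective (Matrix.mulVecLin (toC B)) := by
    rw [injective_iff_map_eq_zero]
    intro v hv
    refine eq_zero_of_re_toC_eq_zero h.viscous_pos ?_
    rw [← reForm_apply, ← reForm_mulVec]
    rw [Matrix.mulVecLin_apply] at hv
    rw [hv, map_zero]
  set e := LinearEquiv.ofInjectiveEndo _ hinj with he
  exact ⟨LinearMap.toContinuousLinearMap e.symm.toLinearMap,
    fun v => e.apply_symm_apply v, fun v => e.symm_apply_apply v⟩

/-- The operator `V ↦ A V` on complex states. -/
noncomputable def jacCLM (A : Matrix (Fin r ⊕ Fin m) (Fin r ⊕ Fin m) ℝ) :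
    (Fin r ⊕ Fin m → ℂ) →L[ℂ] (Fin r ⊕ Fin m → ℂ) :=
  LinearMap.toContinuousLinearMap (Matrix.mulVecLin (toC A))

/-- The state `V` with `V_II = h` and `(A V)_I = -P_I`, where `T` inverts `V ↦ ((A V)_I, V_II)`. -/
noncomputable def recover (T : ((Fin r → ℂ) × (Fin m → ℂ)) →L[ℂ] (Fin r ⊕ Fin m → ℂ)) :
    ((Fin m → ℂ) × (Fin r ⊕ Fin m → ℂ)) →L[ℂ] (Fin r ⊕ Fin m → ℂ) :=
  T.comp ((-(projI ℂ).comp (ContinuousLinearMap.snd ℂ _ _)).prod (ContinuousLinearMap.fst ℂ _ _))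

lemma recover_apply (T : ((Fin r → ℂ) × (Fin m → ℂ)) →L[ℂ] (Fin r ⊕ Fin m → ℂ))
    (h : Fin m → ℂ) (P : Fin r ⊕ Fin m → ℂ) :
    recover T (h, P) = T (-projI ℂ P, h) := rfl

/-- The right-hand side of the integrated resolvent equation. The unknown is `(h, Q)` with
`h = V_II` and `Q = ∫ V`, the data are the flux constant `c` and `Φ = ∫ F`; with
`P = lam Q - Φ` the equations are `h' = B⁻¹ ((A V)_II + c + P_II)` and `Q' = V`. -/
noncomputable def resolventField (A : Matrix (Fin r ⊕ Fin m) (Fin r ⊕ Fin m) ℝ)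
    (T : ((Fin r → ℂ) × (Fin m → ℂ)) →L[ℂ] (Fin r ⊕ Fin m → ℂ))
    (R : (Fin m → ℂ) →L[ℂ] (Fin m → ℂ)) (lam : ℂ) :
    (((Fin m → ℂ) × (Fin r ⊕ Fin m → ℂ)) × ((Fin m → ℂ) × (Fin r ⊕ Fin m → ℂ))) →L[ℂ]
      ((Fin m → ℂ) × (Fin r ⊕ Fin m → ℂ)) :=
  let fst := ContinuousLinearMap.fst ℂ ((Fin m → ℂ) × (Fin r ⊕ Fin m → ℂ))
    ((Fin m → ℂ) × (Fin r ⊕ Fin m → ℂ))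
  let snd := ContinuousLinearMap.snd ℂ ((Fin m → ℂ) × (Fin r ⊕ Fin m → ℂ))
    ((Fin m → ℂ) × (Fin r ⊕ Fin m → ℂ))
  let P := lam • (ContinuousLinearMap.snd ℂ _ _).comp fst - (ContinuousLinearMap.snd ℂ _ _).comp snd
  let V := (recover T).comp (((ContinuousLinearMap.fst ℂ _ _).comp fst).prod P)
  (R.comp ((projII ℂ).comp ((jacCLM A).comp V) + (ContinuousLinearMap.fst ℂ _ _).comp snd +
    (projII ℂ).comp P)).prod V

lemma resolventField_apply (A : Matrix (Fin r ⊕ Fin m) (Fin r ⊕ Fin m) ℝ)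
    (T : ((Fin r → ℂ) × (Fin m → ℂ)) →L[ℂ] (Fin r ⊕ Fin m → ℂ))
    (R : (Fin m → ℂ) →L[ℂ] (Fin m → ℂ)) (lam : ℂ) (Y D : (Fin m → ℂ) × (Fin r ⊕ Fin m → ℂ)) :
    resolventField A T R lam (Y, D) =
      (R (projII ℂ (toC A *ᵥ recover T (Y.1, lam • Y.2 - D.2)) + D.1 +
        projII ℂ (lam • Y.2 - D.2)), recover T (Y.1, lam • Y.2 - D.2)) := rfl

/-- A homogeneous solution of the resolvent equation with `Re lam ≥ 0` has zero flux constant. With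
the flux `J = B V' - A V` and the symmetrizer `S`, the function `E = Re (V* S J) + ½ V* S A V`
has `E' = Re (V'* S B V') + Re lam V* S V ≥ 0`, while `E(0) = 0` and
`E(1) = -½ V_I* S₁₁ A₁₁ V_I ≤ 0`. -/
lemma SymmetrizedPair.flux_eq_zero (h : SymmetrizedPair A B S₁₁ S₂₂)
    {T : ((Fin r → ℂ) × (Fin m → ℂ)) →L[ℂ] (Fin r ⊕ Fin m → ℂ)}
    (hT : ∀ p, projI ℂ (toC A *ᵥ T p) = p.1 ∧ projII ℂ (T p) = p.2)
    {R : (Fin m → ℂ) →L[ℂ] (Fin m → ℂ)} (hR : ∀ v, toC B *ᵥ R v = v)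
    {lam : ℂ} (hlam : 0 ≤ lam.re) {c : Fin m → ℂ} {Y : ℝ → (Fin m → ℂ) × (Fin r ⊕ Fin m → ℂ)}
    (hY : ∀ x ∈ Icc (0 : ℝ) 1,
      HasDerivWithinAt Y (resolventField A T R lam (Y x, (c, 0))) (Icc 0 1) x)
    (hY0 : Y 0 = 0) (hY1 : (Y 1).1 = 0) : c = 0 := by
  set S := Matrix.fromBlocks S₁₁ 0 0 S₂₂ with hS
  set v : ℝ → Fin r ⊕ Fin m → ℂ := fun x => recover T ((Y x).1, lam • (Y x).2) with hv
  set h' : ℝ → Fin m → ℂ := fun x =>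
    R (projII ℂ (toC A *ᵥ v x) + c + projII ℂ (lam • (Y x).2)) with hh'
  set v' : ℝ → Fin r ⊕ Fin m → ℂ := fun x => recover T (h' x, lam • v x) with hv'
  set w : ℝ → Fin r ⊕ Fin m → ℂ := fun x => glue ℂ (0, c) + lam • (Y x).2 with hw
  have hfield : ∀ x, resolventField A T R lam (Y x, (c, 0)) = (h' x, v x) := fun x => by
    rw [resolventField_apply]
    simp only [sub_zero]
    rfl
  have hvI : ∀ x, projI ℂ (toC A *ᵥ v x) = -projI ℂ (lam • (Y x).2) := fun x => (hT _).1
  have hvII : ∀ x, projII ℂ (v x) = (Y x).1 := fun x => (hT _).2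
  have hvII' : ∀ x, projII ℂ (v' x) = h' x := fun x => (hT _).2
  -- the flux identity `A V + J = B V'`
  have hflux : ∀ x, w x + toC A *ᵥ v x = glue ℂ (0, toC B *ᵥ h' x) := fun x => by
    rw [← glue_proj ℂ (w x + toC A *ᵥ v x)]
    congr 1
    refine Prod.ext ?_ ?_
    · change projI ℂ (glue ℂ (0, c) + lam • (Y x).2 + toC A *ᵥ v x) = 0
      rw [map_add, hvI, map_add, projI_glue, zero_add, add_neg_cancel]
    · change projII ℂ (glue ℂ (0, c) + lam • (Y x).2 + toC A *ᵥ v x) = toC B *ᵥ h' x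
      rw [hh']
      simp only
      rw [hR, map_add, map_add, projII_glue]
      abel
  have hYd : ∀ x ∈ Icc (0 : ℝ) 1, HasDerivWithinAt Y (h' x, v x) (Icc 0 1) x := fun x hx => by
    rw [← hfield]; exact hY x hx
  have hY1d : ∀ x ∈ Icc (0 : ℝ) 1, HasDerivWithinAt (fun x => (Y x).1) (h' x) (Icc 0 1) x :=
    fun x hx => (ContinuousLinearMap.fst ℝ (Fin m → ℂ)
      (Fin r ⊕ Fin m → ℂ)).hasFDerivAt.comp_hasDerivWithinAt x (hYd x hx)
  have hY2d : ∀ x ∈ Icc (0 : ℝ) 1,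
      HasDerivWithinAt (fun x => lam • (Y x).2) (lam • v x) (Icc 0 1) x := fun x hx =>
    ((ContinuousLinearMap.snd ℝ (Fin m → ℂ)
      (Fin r ⊕ Fin m → ℂ)).hasFDerivAt.comp_hasDerivWithinAt x (hYd x hx)).const_smul lam
  have hvd : ∀ x ∈ Icc (0 : ℝ) 1, HasDerivWithinAt v (v' x) (Icc 0 1) x := fun x hx =>
    ((recover T).restrictScalars ℝ).hasFDerivAt.comp_hasDerivWithinAt x
      ((hY1d x hx).prodMk (hY2d x hx))
  have hwd : ∀ x ∈ Icc (0 : ℝ) 1, HasDerivWithinAt w (lam • v x) (Icc 0 1) x := fun x hx =>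
    (hY2d x hx).const_add _
  have hAd : ∀ x ∈ Icc (0 : ℝ) 1,
      HasDerivWithinAt (fun x => toC A *ᵥ v x) (toC A *ᵥ v' x) (Icc 0 1) x := fun x hx =>
    ((jacCLM A).restrictScalars ℝ).hasFDerivAt.comp_hasDerivWithinAt x (hvd x hx)
  have hE : ∀ x ∈ Icc (0 : ℝ) 1, HasDerivWithinAt
      (fun x => reForm S (v x) (w x) + (1 / 2 : ℝ) * reForm S (v x) (toC A *ᵥ v x))
      (reForm (S₂₂ * B) (h' x) (h' x) + lam.re * reForm S (v x) (v x)) (Icc 0 1) x := by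
    intro x hx
    refine ((hasDerivWithinAt_bilin (reForm S) (hvd x hx) (hwd x hx)).add
      ((hasDerivWithinAt_bilin (reForm S) (hvd x hx) (hAd x hx)).const_mul
        (1 / 2 : ℝ))).congr_deriv ?_
    have h1 : reForm S (v x) (toC A *ᵥ v' x) = reForm S (v' x) (toC A *ᵥ v x) := by
      rw [reForm_mulVec, reForm_mulVec, reForm_comm h.symm_mul]
    have h2 : reForm S (v' x) (w x) + reForm S (v' x) (toC A *ᵥ v x) =
        reForm (S₂₂ * B) (h' x) (h' x) := by
      rw [← map_add, hflux, reForm_fromBlocks_glue, hvII', map_zero, zero_add, reForm_mulVec]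
    rw [h1, reForm_smul_self h.symm, ← h2]
    ring
  have hnn1 : ∀ x, 0 ≤ reForm (S₂₂ * B) (h' x) (h' x) := fun x =>
    re_toC_nonneg h.viscous_pos _
  have hnn2 : ∀ x, 0 ≤ lam.re * reForm S (v x) (v x) := fun x =>
    mul_nonneg hlam (re_toC_nonneg h.pos _)
  have hv0 : v 0 = 0 := by
    simp only [hv, hY0, Prod.fst_zero, Prod.snd_zero, smul_zero]
    exact map_zero (recover T)
  have hend : reForm S (v 1) (w 1) + (1 / 2 : ℝ) * reForm S (v 1) (toC A *ᵥ v 1) ≤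
      reForm S (v 0) (w 0) + (1 / 2 : ℝ) * reForm S (v 0) (toC A *ᵥ v 0) := by
    have hII : projII ℂ (v 1) = 0 := by rw [hvII, hY1]
    have h1 : ∀ y, reForm S (v 1) y = reForm S₁₁ (projI ℂ (v 1)) (projI ℂ y) := fun y => by
      conv_lhs => rw [← glue_proj ℂ y]
      rw [reForm_fromBlocks_glue, hII]
      simp
    have h2 : projI ℂ (w 1) = -projI ℂ (toC A *ᵥ v 1) := by
      rw [hvI, neg_neg]
      change projI ℂ (glue ℂ (0, c) + lam • (Y 1).2) = _
      rw [map_add, projI_glue, zero_add]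
    have h3 : 0 ≤ reForm S₁₁ (projI ℂ (v 1)) (projI ℂ (toC A *ᵥ v 1)) := by
      rw [projI_toC_mulVec_of_projII_eq_zero A hII, reForm_mulVec]
      exact re_toC_nonneg h.hyperbolic_pos _
    rw [h1, h1, h2, map_neg, hv0]
    simp only [map_zero, LinearMap.zero_apply, mul_zero, add_zero]
    linarith
  have hzero := deriv_eq_zero_of_nonneg_of_le hE (fun x _ => add_nonneg (hnn1 x) (hnn2 x)) hend
    0 (by simp)
  have hh0 : h' 0 = 0 := eq_zero_of_re_toC_eq_zero h.viscous_pos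
    (le_antisymm (by rw [← reForm_apply]; linarith [hnn2 0]) (hnn1 0))
  have h4 := congrArg (projII ℂ) (hflux 0)
  rw [hv0, hh0, Matrix.mulVec_zero, Matrix.mulVec_zero, add_zero, projII_glue] at h4
  change projII ℂ (glue ℂ (0, c) + lam • (Y 0).2) = 0 at h4
  rw [hY0] at h4
  simpa using h4

/-- The integrated resolvent problem is solvable with a bound: the flux constant `c` enters the
endpoint `V_II(1)` through a linear map of `ℂᵐ`, which is injective, hence invertible. -/
lemma SymmetrizedPair.exists_resolvent_system (h : SymmetrizedPair A B S₁₁ S₂₂)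
    {T : ((Fin r → ℂ) × (Fin m → ℂ)) →L[ℂ] (Fin r ⊕ Fin m → ℂ)}
    (hT : ∀ p, projI ℂ (toC A *ᵥ T p) = p.1 ∧ projII ℂ (T p) = p.2)
    {R : (Fin m → ℂ) →L[ℂ] (Fin m → ℂ)} (hR : ∀ v, toC B *ᵥ R v = v)
    {lam : ℂ} (hlam : 0 ≤ lam.re) :
    ∃ K, 0 ≤ K ∧ ∀ (Φ : ℝ → Fin r ⊕ Fin m → ℂ) (C : ℝ), Continuous Φ →
      (∀ x ∈ Icc (0 : ℝ) 1, ‖Φ x‖ ≤ C) →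
      ∃ (c : Fin m → ℂ) (Y : ℝ → (Fin m → ℂ) × (Fin r ⊕ Fin m → ℂ)),
        (∀ x, HasDerivAt Y (resolventField A T R lam (Y x, (c, Φ x))) x) ∧
        Y 0 = 0 ∧ (Y 1).1 = 0 ∧ ∀ x ∈ Icc (0 : ℝ) 1, ‖Y x‖ ≤ K * C := by
  set M := ((resolventField A T R lam).comp (ContinuousLinearMap.inl ℂ _ _)).restrictScalars ℝ
    with hM
  set J := ((resolventField A T R lam).comp (ContinuousLinearMap.inr ℂ _ _)).restrictScalars ℝ
    with hJ
  have hMJ : ∀ y d, resolventField A T R lam (y, d) = M y + J d := fun y d => by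
    have : ((y, d) : ((Fin m → ℂ) × (Fin r ⊕ Fin m → ℂ)) × ((Fin m → ℂ) × (Fin r ⊕ Fin m → ℂ))) =
        (y, 0) + (0, d) := by simp
    rw [this, map_add]; rfl
  set N : (Fin m → ℂ) →L[ℝ] (Fin m → ℂ) :=
    (((ContinuousLinearMap.fst ℝ (Fin m → ℂ) (Fin r ⊕ Fin m → ℂ)).comp
      (NormedSpace.exp ((1 : ℝ) • M))).comp
      (∫ s in (0 : ℝ)..1, NormedSpace.exp ((-s) • M))).comp
      (J.comp (ContinuousLinearMap.inl ℝ (Fin m → ℂ) (Fin r ⊕ Fin m → ℂ))) with hN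
  have hexp : Continuous fun s : ℝ => NormedSpace.exp ((-s) • M) :=
    (continuous_exp_smul M).comp continuous_neg
  have hNc : ∀ c, N c = (duhamel M (fun _ => J (c, 0)) 1).1 := fun c => by
    rw [duhamel, ← ContinuousLinearMap.intervalIntegral_apply (hexp.intervalIntegrable 0 1)]
    rfl
  have hNinj : Function.Injective (N : (Fin m → ℂ) →ₗ[ℝ] (Fin m → ℂ)) := by
    rw [injective_iff_map_eq_zero]
    intro c hc
    refine h.flux_eq_zero hT hR hlam (Y := duhamel M fun _ => J (c, 0)) (fun x _ => ?_)
      (duhamel_zero _ _) ((hNc c).symm.trans hc)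
    rw [hMJ]
    exact (hasDerivAt_duhamel M continuous_const x).hasDerivWithinAt
  set e := LinearEquiv.ofInjectiveEndo _ hNinj with he
  set N' : (Fin m → ℂ) →L[ℝ] (Fin m → ℂ) :=
    LinearMap.toContinuousLinearMap e.symm.toLinearMap with hN'
  have hNN' : ∀ c, N (N' c) = c := fun c => e.apply_symm_apply c
  obtain ⟨K, hK0, hK⟩ := exists_bound_duhamel M
  refine ⟨K * ‖J‖ + K * (‖J‖ * (‖N'‖ * (K * ‖J‖))), by positivity, fun Φ C hΦ hC => ?_⟩
  have hC0 : 0 ≤ C := (norm_nonneg _).trans (hC 0 (by simp))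
  have hg : Continuous fun x => J (0, Φ x) := by fun_prop
  set Y₀ := duhamel M fun x => J (0, Φ x) with hY₀
  have hJb : ∀ x ∈ Icc (0 : ℝ) 1, ‖J (0, Φ x)‖ ≤ ‖J‖ * C := fun x hx => by
    refine (J.le_opNorm _).trans (mul_le_mul_of_nonneg_left ?_ (norm_nonneg J))
    rw [Prod.norm_def, norm_zero, max_eq_right (norm_nonneg _)]
    exact hC x hx
  have hY₀b : ∀ x ∈ Icc (0 : ℝ) 1, ‖Y₀ x‖ ≤ K * (‖J‖ * C) := hK _ _ hJb
  set c := -N' (Y₀ 1).1 with hc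
  have hcb : ‖c‖ ≤ ‖N'‖ * (K * (‖J‖ * C)) := by
    rw [hc, norm_neg]
    exact (N'.le_opNorm _).trans (mul_le_mul_of_nonneg_left
      ((norm_fst_le _).trans (hY₀b 1 (by simp))) (norm_nonneg _))
  set Y₁ := duhamel M fun _ => J (c, 0) with hY₁
  have hY₁b : ∀ x ∈ Icc (0 : ℝ) 1, ‖Y₁ x‖ ≤ K * (‖J‖ * (‖N'‖ * (K * (‖J‖ * C)))) := by
    refine hK _ _ fun x _ => (J.le_opNorm _).trans
      (mul_le_mul_of_nonneg_left ?_ (norm_nonneg J))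
    rw [Prod.norm_def, norm_zero, max_eq_left (norm_nonneg _)]
    exact hcb
  refine ⟨c, fun x => Y₀ x + Y₁ x, fun x => ?_, ?_, ?_, fun x hx => ?_⟩
  · refine ((hasDerivAt_duhamel M hg x).add
      (hasDerivAt_duhamel M (g := fun _ => J (c, 0)) continuous_const x)).congr_deriv ?_
    have hsplit : J (c, Φ x) = J (0, Φ x) + J (c, 0) := by rw [← map_add]; simp
    rw [hMJ, map_add, hsplit]
    abel
  · simp [hY₀, hY₁]
  · rw [Prod.fst_add, ← hNc, hc, map_neg, hNN', add_neg_cancel]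
  · refine (norm_add_le _ _).trans ((add_le_add (hY₀b x hx) (hY₁b x hx)).trans (le_of_eq ?_))
    ring

end Resolvent

/-! ### Primitives of square-integrable functions -/

lemma L2.integrableOn (F : L2 r m) : IntegrableOn F (Icc 0 1) :=
  (Lp.memLp F).integrable (by norm_num)

lemma intervalIntegrable_of_mem {E : Type*} [NormedAddCommGroup E] {F : ℝ → E}
    (hF : IntegrableOn F (Icc 0 1)) {x : ℝ} (hx : x ∈ Icc (0 : ℝ) 1) :
    IntervalIntegrable F volume 0 x := by
  rw [intervalIntegrable_iff_integrableOn_Icc_of_le hx.1]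
  exact hF.mono_set (Icc_subset_Icc_right hx.2)

lemma intervalIntegral_congr_of_mem {E : Type*} [NormedAddCommGroup E] [NormedSpace ℝ E]
    {F G : ℝ → E} (h : ∀ᵐ x ∂(volume : Measure ℝ).restrict (Icc 0 1), F x = G x) {x : ℝ}
    (hx : x ∈ Icc (0 : ℝ) 1) : ∫ y in (0 : ℝ)..x, F y = ∫ y in (0 : ℝ)..x, G y := by
  refine intervalIntegral.integral_congr_ae_restrict (ae_restrict_of_ae_restrict_of_subset ?_ h)
  rw [uIoc_of_le hx.1]
  exact Ioc_subset_Icc_self.trans (Icc_subset_Icc_right hx.2)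

lemma continuousOn_primitive_Icc {E : Type*} [NormedAddCommGroup E] [NormedSpace ℝ E]
    {F : ℝ → E} (hF : IntegrableOn F (Icc 0 1)) :
    ContinuousOn (fun x => ∫ y in (0 : ℝ)..x, F y) (Icc 0 1) := by
  rw [← uIcc_of_le (zero_le_one' ℝ)] at hF ⊢
  exact intervalIntegral.continuousOn_primitive_interval hF

lemma L2.intervalIntegral_smul_add (a : ℂ) (F G : L2 r m) {x : ℝ} (hx : x ∈ Icc (0 : ℝ) 1) :
    ∫ y in (0 : ℝ)..x, (a • F + G : L2 r m) y =
      a • (∫ y in (0 : ℝ)..x, F y) + ∫ y in (0 : ℝ)..x, G y := by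
  rw [intervalIntegral_congr_of_mem (G := fun y => a • F y + G y) ?_ hx,
    intervalIntegral.integral_add (f := fun y => a • F y)
      ((intervalIntegrable_of_mem F.integrableOn hx).smul a)
      (intervalIntegrable_of_mem G.integrableOn hx), intervalIntegral.integral_smul]
  filter_upwards [Lp.coeFn_add (a • F) G, Lp.coeFn_smul a F] with y h1 h2
  rw [h1, Pi.add_apply, h2, Pi.smul_apply]

/-- The interval has length one, so the `L¹` norm is at most the `L²` norm. -/
lemma L2.norm_primitive_le (F : L2 r m) {x : ℝ} (hx : x ∈ Icc (0 : ℝ) 1) :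
    ‖∫ y in (0 : ℝ)..x, F y‖ ≤ ‖F‖ := by
  have : IsProbabilityMeasure ((volume : Measure ℝ).restrict (Icc 0 1)) := ⟨by simp⟩
  calc ‖∫ y in (0 : ℝ)..x, F y‖ ≤ ∫ y in (0 : ℝ)..x, ‖F y‖ :=
        intervalIntegral.norm_integral_le_integral_norm hx.1
    _ = ∫ y in Ioc 0 x, ‖F y‖ := intervalIntegral.integral_of_le hx.1
    _ ≤ ∫ y in Icc 0 1, ‖F y‖ := setIntegral_mono_set F.integrableOn.norm
        (Filter.Eventually.of_forall fun y => norm_nonneg _)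
        (Ioc_subset_Icc_self.trans (Icc_subset_Icc_right hx.2)).eventuallyLE
    _ ≤ ‖F‖ := by
        rw [integral_norm_eq_lintegral_enorm (Lp.aestronglyMeasurable F),
          ← eLpNorm_one_eq_lintegral_enorm, Lp.norm_def]
        exact ENNReal.toReal_mono (Lp.eLpNorm_ne_top F)
          (eLpNorm_le_eLpNorm_of_exponent_le (by norm_num) (Lp.aestronglyMeasurable F))

lemma memLp_Icc_of_continuousOn {E : Type*} [NormedAddCommGroup E] {F : ℝ → E}
    (hF : ContinuousOn F (Icc 0 1)) :
    MemLp F 2 ((volume : Measure ℝ).restrict (Icc 0 1)) := by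
  obtain ⟨C, hC⟩ := isCompact_Icc.exists_bound_of_continuousOn hF
  exact MemLp.of_bound (hF.aestronglyMeasurable_of_isCompact isCompact_Icc measurableSet_Icc) C
    ((ae_restrict_mem measurableSet_Icc).mono hC)

/-! ### The linearization at a constant state -/

/-- The graph of `V ↦ (B V' - A V)'` with constant coefficients, where only the block `B` of the
viscosity matrix is nonzero, and with the boundary conditions `V(0) = 0`, `V_II(1) = 0`. -/
def ConstantGraph (A : Matrix (Fin r ⊕ Fin m) (Fin r ⊕ Fin m) ℝ) (B : Matrix (Fin m) (Fin m) ℝ)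
    (V G : L2 r m) : Prop :=
  ∃ (v : ℝ → Fin r ⊕ Fin m → ℂ) (w : L2 r m) (c : Fin r ⊕ Fin m → ℂ),
    (∀ᵐ x ∂((volume : Measure ℝ).restrict (Icc 0 1)), V x = v x) ∧
    (∀ x ∈ Icc (0 : ℝ) 1, v x = ∫ y in (0 : ℝ)..x, w y) ∧
    projII ℂ (v 1) = 0 ∧
    ∀ᵐ x ∂((volume : Measure ℝ).restrict (Icc 0 1)),
      glue ℂ (0, toC B *ᵥ projII ℂ (w x)) - toC A *ᵥ v x = c + ∫ y in (0 : ℝ)..x, G y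

lemma linFlux_zero_deriv (f : StateVec r m → StateVec r m)
    (B₂₂ : StateVec r m → Matrix (Fin m) (Fin m) ℝ) (U : StateVec r m)
    (v w : Fin r ⊕ Fin m → ℂ) :
    linFlux f B₂₂ U 0 v w =
      glue ℂ (0, toC (B₂₂ U) *ᵥ projII ℂ w) - toC (jac f U) *ᵥ v := by
  have h1 : toC (visc B₂₂ U) *ᵥ w = glue ℂ (0, toC (B₂₂ U) *ᵥ projII ℂ w) := by
    conv_lhs => rw [visc, toC_fromBlocks, ← glue_proj ℂ w]
    rw [fromBlocks_mulVec_glue]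
    congr 2
    ext i; simp [toC, Matrix.mulVec, dotProduct]
  have h2 : (fun k => (((0 : StateVec r m) k : ℝ) : ℂ)) = 0 := by ext k; simp
  rw [linFlux, h1, h2, Matrix.mulVec_zero, add_zero]

lemma linearizedGraph_iff_of_const {f : StateVec r m → StateVec r m}
    {B₂₂ : StateVec r m → Matrix (Fin m) (Fin m) ℝ} {U₀ : StateVec r m} {U : ℝ → StateVec r m}
    (hU : ∀ x ∈ Icc (0 : ℝ) 1, U x = U₀) (V G : L2 r m) :
    LinearizedGraph f B₂₂ U V G ↔ ConstantGraph (jac f U₀) (B₂₂ U₀) V G := by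
  have hint : ∀ᵐ x ∂((volume : Measure ℝ).restrict (Icc 0 1)), x ∈ Ioo (0 : ℝ) 1 := by
    rw [← restrict_Ioo_eq_restrict_Icc]
    exact ae_restrict_mem measurableSet_Ioo
  have key : ∀ᵐ x ∂((volume : Measure ℝ).restrict (Icc 0 1)), ∀ v w,
      linFlux f B₂₂ (U x) (deriv U x) v w =
        glue ℂ (0, toC (B₂₂ U₀) *ᵥ projII ℂ w) - toC (jac f U₀) *ᵥ v := by
    filter_upwards [hint] with x hx v w
    have hd : deriv U x = 0 := by
      have : U =ᶠ[𝓝 x] fun _ => U₀ := by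
        filter_upwards [isOpen_Ioo.mem_nhds hx] with y hy using hU y (Ioo_subset_Icc_self hy)
      rw [this.deriv_eq, deriv_const]
    rw [hd, hU x (Ioo_subset_Icc_self hx), linFlux_zero_deriv]
  refine exists_congr fun v => exists_congr fun w => exists_congr fun c =>
    and_congr_right fun _ => and_congr_right fun _ => and_congr ?_ ?_
  · exact ⟨fun h => funext h, fun h j => congrFun h j⟩
  · refine ⟨fun h => ?_, fun h => ?_⟩ <;>
    · filter_upwards [h, key] with x hx hk
      simpa only [hk] using hx

lemma ConstantGraph.smul_add {A : Matrix (Fin r ⊕ Fin m) (Fin r ⊕ Fin m) ℝ}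
    {B : Matrix (Fin m) (Fin m) ℝ} {V V' G G' : L2 r m} (a : ℂ) (h : ConstantGraph A B V G)
    (h' : ConstantGraph A B V' G') : ConstantGraph A B (a • V + V') (a • G + G') := by
  obtain ⟨v, w, c, hV, hv, h1, hc⟩ := h
  obtain ⟨v', w', c', hV', hv', h1', hc'⟩ := h'
  refine ⟨fun x => a • v x + v' x, a • w + w', a • c + c', ?_, fun x hx => ?_, ?_, ?_⟩
  · filter_upwards [hV, hV', Lp.coeFn_add (a • V) V', Lp.coeFn_smul a V] with x e1 e2 e3 e4
    rw [e3, Pi.add_apply, e4, Pi.smul_apply, e1, e2]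
  · rw [L2.intervalIntegral_smul_add a w w' hx, ← hv x hx, ← hv' x hx]
  · rw [map_add, map_smul, h1, h1', smul_zero, add_zero]
  · filter_upwards [hc, hc', Lp.coeFn_add (a • w) w', Lp.coeFn_smul a w,
      ae_restrict_mem measurableSet_Icc] with x e1 e2 e3 e4 hx
    have e5 : glue ℂ ((0 : Fin r → ℂ), toC B *ᵥ projII ℂ ((a • w + w' : L2 r m) x)) =
        a • glue ℂ (0, toC B *ᵥ projII ℂ (w x)) + glue ℂ (0, toC B *ᵥ projII ℂ (w' x)) := by
      rw [e3, Pi.add_apply, e4, Pi.smul_apply, ← map_smul, ← map_add, map_add, map_smul,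
        Matrix.mulVec_add, Matrix.mulVec_smul, Prod.smul_mk, Prod.mk_add_mk, smul_zero, add_zero]
    rw [e5, L2.intervalIntegral_smul_add a G G' hx, Matrix.mulVec_add, Matrix.mulVec_smul,
      add_sub_add_comm, ← smul_sub, e1, e2]
    module

/-- A linear relation that is solvable with a bound and has unique solutions is the graph of a
bounded operator. -/
lemma exists_clm_of_relation {E : Type*} [NormedAddCommGroup E] [NormedSpace ℂ E]
    {P : E → E → Prop} (hP : ∀ (a : ℂ) {F V F' V'}, P F V → P F' V' → P (a • F + F') (a • V + V'))
    {K : ℝ} (hex : ∀ F, ∃ V, P F V ∧ ‖V‖ ≤ K * ‖F‖) (huniq : ∀ V, P 0 V → V = 0) :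
    ∃ R : E →L[ℂ] E, ∀ F V, R F = V ↔ P F V := by
  choose S hS hb using hex
  have hu : ∀ {F V V'}, P F V → P F V' → V = V' := fun {F V V'} h h' => by
    have := huniq ((-1 : ℂ) • V + V') (by simpa using hP (-1) h h')
    rw [neg_one_smul, neg_add_eq_zero] at this
    exact this
  have hlin : ∀ (a : ℂ) F F', S (a • F + F') = a • S F + S F' := fun a F F' =>
    hu (hS _) (hP a (hS F) (hS F'))
  have h0 : S 0 = 0 := huniq _ (hS 0)
  refine ⟨LinearMap.mkContinuous
    { toFun := S
      map_add' := fun F F' => by simpa using hlin 1 F F'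
      map_smul' := fun a F => by simpa [h0] using hlin a F 0 } K hb, fun F V => ?_⟩
  exact ⟨fun h => h ▸ hS F, fun h => hu (hS F) h⟩

/-! ### Spectral stability of constant states -/

section Resolvent

variable {A : Matrix (Fin r ⊕ Fin m) (Fin r ⊕ Fin m) ℝ} {B : Matrix (Fin m) (Fin m) ℝ}
  {S₁₁ : Matrix (Fin r) (Fin r) ℝ} {S₂₂ : Matrix (Fin m) (Fin m) ℝ}

/-- `λ - L` is injective for `Re λ ≥ 0`. The flux equation, known almost everywhere, makes `V_II`
continuously differentiable and determines `V_I`, so that `(V_II, ∫ V)` is a classical solution of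
the homogeneous resolvent system. -/
lemma SymmetrizedPair.constantGraph_eq_zero (h : SymmetrizedPair A B S₁₁ S₂₂) {lam : ℂ}
    (hlam : 0 ≤ lam.re) {V : L2 r m} (hV : ConstantGraph A B V (lam • V)) : V = 0 := by
  obtain ⟨T, hT, hT'⟩ := h.exists_tangent
  obtain ⟨R, hR, hR'⟩ := h.exists_viscous_inverse
  obtain ⟨v, w, c, hVv, hv, hv1, hflux⟩ := hV
  have hvc : ContinuousOn v (Icc 0 1) :=
    (continuousOn_primitive_Icc w.integrableOn).congr hv
  set u : ℝ → Fin r ⊕ Fin m → ℂ := extend ⟨(Icc (0 : ℝ) 1).domRestrict v, hvc.domRestrict⟩ with hu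
  have huc : Continuous u := continuous_extend _
  have huv : ∀ x ∈ Icc (0 : ℝ) 1, u x = v x := fun x hx => extend_of_mem _ hx
  set Q : ℝ → Fin r ⊕ Fin m → ℂ := fun x => ∫ y in (0 : ℝ)..x, u y with hQ
  have hQd : ∀ x, HasDerivAt Q (u x) x := fun x => huc.integral_hasStrictDerivAt 0 x |>.hasDerivAt
  have hQc : Continuous Q := continuous_iff_continuousAt.mpr fun x => (hQd x).continuousAt
  have hVu : ∀ᵐ x ∂((volume : Measure ℝ).restrict (Icc 0 1)), V x = u x := by
    filter_upwards [hVv, ae_restrict_mem measurableSet_Icc] with x h1 hx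
    rw [h1, huv x hx]
  have hVQ : ∀ x ∈ Icc (0 : ℝ) 1, ∫ y in (0 : ℝ)..x, (lam • V : L2 r m) y = lam • Q x := by
    intro x hx
    rw [hQ, ← intervalIntegral.integral_smul]
    refine intervalIntegral_congr_of_mem ?_ hx
    filter_upwards [hVu, Lp.coeFn_smul lam V] with y h1 h2
    rw [h2, Pi.smul_apply, h1]
  set q : ℝ → Fin r ⊕ Fin m → ℂ := fun x => toC A *ᵥ u x + c + lam • Q x with hq
  have hqc : Continuous q :=
    (((jacCLM A).continuous.comp huc).add continuous_const).add (hQc.const_smul lam)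
  have hae : ∀ᵐ x ∂((volume : Measure ℝ).restrict (Icc 0 1)),
      glue ℂ (0, toC B *ᵥ projII ℂ (w x)) = q x := by
    filter_upwards [hflux, ae_restrict_mem measurableSet_Icc] with x h1 hx
    rw [hVQ x hx, ← huv x hx, sub_eq_iff_eq_add] at h1
    rw [h1, hq]
    simp only
    abel
  -- the hyperbolic part holds almost everywhere, hence everywhere by continuity
  have hI : EqOn (fun x => projI ℂ (q x)) (fun _ => 0) (Icc 0 1) := by
    refine Measure.eqOn_Icc_of_ae_eq volume zero_ne_one ?_
      ((projI ℂ).continuous.comp hqc).continuousOn continuousOn_const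
    filter_upwards [hae] with x hx
    rw [← hx, projI_glue]
  have hu0 : u 0 = 0 := by
    rw [huv 0 (by simp), hv 0 (by simp), intervalIntegral.integral_same]
  have hcI : projI ℂ c = 0 := by
    have := hI (show (0 : ℝ) ∈ Icc (0 : ℝ) 1 by simp)
    simpa [hq, hu0, hQ] using this
  have hrec : ∀ x ∈ Icc (0 : ℝ) 1, recover T (projII ℂ (u x), lam • Q x) = u x := by
    intro x hx
    have h1 : projI ℂ (toC A *ᵥ u x) = -projI ℂ (lam • Q x) := by
      have h2 := hI hx
      simp only [hq, map_add, hcI, add_zero] at h2 ⊢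
      exact eq_neg_of_add_eq_zero_left h2
    rw [recover_apply, ← h1, hT']
  set g : ℝ → Fin m → ℂ := fun x => R (projII ℂ (q x)) with hg
  have hgc : Continuous g := R.continuous.comp ((projII ℂ).continuous.comp hqc)
  have hwg : ∀ᵐ x ∂((volume : Measure ℝ).restrict (Icc 0 1)), projII ℂ (w x) = g x := by
    filter_upwards [hae] with x hx
    rw [hg]
    simp only
    rw [← hx, projII_glue, hR']
  have hint : ∀ x ∈ Icc (0 : ℝ) 1, projII ℂ (u x) = ∫ y in (0 : ℝ)..x, g y := by
    intro x hx
    rw [huv x hx, hv x hx, ← intervalIntegral_congr_of_mem hwg hx]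
    exact ((projII ℂ).intervalIntegral_comp_comm
      (intervalIntegrable_of_mem w.integrableOn hx)).symm
  have hII : ∀ x ∈ Icc (0 : ℝ) 1,
      HasDerivWithinAt (fun x => projII ℂ (u x)) (g x) (Icc 0 1) x := fun x hx =>
    ((hgc.integral_hasStrictDerivAt 0 x).hasDerivAt.hasDerivWithinAt).congr hint (hint x hx)
  have hY : ∀ x ∈ Icc (0 : ℝ) 1, HasDerivWithinAt (fun x => (projII ℂ (u x), Q x))
      (resolventField A T R lam ((projII ℂ (u x), Q x), (projII ℂ c, 0))) (Icc 0 1) x := by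
    intro x hx
    refine ((hII x hx).prodMk (hQd x).hasDerivWithinAt).congr_deriv ?_
    rw [resolventField_apply]
    simp only [sub_zero]
    rw [hrec x hx, hg]
    simp only [hq, map_add]
  have hY0 : ((projII ℂ (u 0), Q 0) : (Fin m → ℂ) × (Fin r ⊕ Fin m → ℂ)) = 0 := by
    rw [hu0, map_zero, hQ]
    simp
  have hcII : projII ℂ c = 0 := h.flux_eq_zero hT hR hlam hY hY0 (by
    simp only
    rw [huv 1 (by simp), hv1])
  have hzero := eqOn_of_linear_ode
    (((resolventField A T R lam).comp (ContinuousLinearMap.inl ℂ _ _)).restrictScalars ℝ)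
    (g := 0) (Y := fun x => (projII ℂ (u x), Q x)) (Z := fun _ => 0)
    (fun x hx => (hY x hx).congr_deriv (by rw [hcII, Pi.zero_apply, add_zero]; rfl))
    (fun x _ => (hasDerivWithinAt_const x _ _).congr_deriv (by rw [map_zero]; simp)) hY0
  refine Lp.ext ?_
  filter_upwards [hVu, ae_restrict_mem measurableSet_Icc,
    Lp.coeFn_zero (Fin r ⊕ Fin m → ℂ) 2 ((volume : Measure ℝ).restrict (Icc 0 1))] with x h1 hx h2
  have h3 := hzero hx
  simp only [Prod.mk_eq_zero] at h3
  rw [h1, h2, Pi.zero_apply, ← hrec x hx, h3.1, h3.2, smul_zero]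
  exact map_zero (recover T)

/-- `λ - L` is onto for `Re λ ≥ 0`, with a bound on a preimage. -/
lemma SymmetrizedPair.exists_constantGraph (h : SymmetrizedPair A B S₁₁ S₂₂) {lam : ℂ}
    (hlam : 0 ≤ lam.re) :
    ∃ K, ∀ F : L2 r m, ∃ V : L2 r m, ConstantGraph A B V (lam • V - F) ∧ ‖V‖ ≤ K * ‖F‖ := by
  obtain ⟨T, hT, -⟩ := h.exists_tangent
  obtain ⟨R, hR, -⟩ := h.exists_viscous_inverse
  obtain ⟨K, hK0, hK⟩ := h.exists_resolvent_system hT hR hlam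
  refine ⟨‖recover T‖ * (K + (‖lam‖ * K + 1)), fun F => ?_⟩
  have hFc := continuousOn_primitive_Icc F.integrableOn
  set Φ : ℝ → Fin r ⊕ Fin m → ℂ :=
    extend ⟨(Icc (0 : ℝ) 1).domRestrict fun x => ∫ y in (0 : ℝ)..x, F y, hFc.domRestrict⟩ with hΦ
  have hΦc : Continuous Φ := continuous_extend _
  have hΦF : ∀ x ∈ Icc (0 : ℝ) 1, Φ x = ∫ y in (0 : ℝ)..x, F y := fun x hx => extend_of_mem _ hx
  have hΦb : ∀ x ∈ Icc (0 : ℝ) 1, ‖Φ x‖ ≤ ‖F‖ := fun x hx => by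
    rw [hΦF x hx]; exact F.norm_primitive_le hx
  obtain ⟨c, Y, hYd, hY0, hY1, hYb⟩ := hK Φ ‖F‖ hΦc hΦb
  have hYc : Continuous Y := continuous_iff_continuousAt.mpr fun x => (hYd x).continuousAt
  set v : ℝ → Fin r ⊕ Fin m → ℂ := fun x => recover T ((Y x).1, lam • (Y x).2 - Φ x) with hv
  set g : ℝ → Fin m → ℂ := fun x =>
    R (projII ℂ (toC A *ᵥ v x) + c + projII ℂ (lam • (Y x).2 - Φ x)) with hg
  have hvc : Continuous v := (recover T).continuous.comp (by fun_prop)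
  have hgc : Continuous g := R.continuous.comp
    ((((projII ℂ).continuous.comp ((jacCLM A).continuous.comp hvc)).add continuous_const).add
      ((projII ℂ).continuous.comp (by fun_prop)))
  have hYd' : ∀ x, HasDerivAt Y (g x, v x) x := hYd
  have hYi : ∀ x, ∫ y in (0 : ℝ)..x, (g y, v y) = Y x := fun x => by
    rw [intervalIntegral.integral_eq_sub_of_hasDerivAt (fun y _ => hYd' y)
      ((hgc.prodMk hvc).intervalIntegrable _ _), hY0, sub_zero]
  have hY1i : ∀ x, ∫ y in (0 : ℝ)..x, g y = (Y x).1 := fun x => by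
    rw [← hYi x]
    exact (ContinuousLinearMap.fst ℝ (Fin m → ℂ) (Fin r ⊕ Fin m → ℂ)).intervalIntegral_comp_comm
      ((hgc.prodMk hvc).intervalIntegrable _ _)
  have hY2i : ∀ x, ∫ y in (0 : ℝ)..x, v y = (Y x).2 := fun x => by
    rw [← hYi x]
    exact (ContinuousLinearMap.snd ℝ (Fin m → ℂ) (Fin r ⊕ Fin m → ℂ)).intervalIntegral_comp_comm
      ((hgc.prodMk hvc).intervalIntegrable _ _)
  have hvL : MemLp v 2 ((volume : Measure ℝ).restrict (Icc 0 1)) :=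
    memLp_Icc_of_continuousOn hvc.continuousOn
  have hpL : MemLp (fun x => (g x, lam • v x - F x)) 2
      ((volume : Measure ℝ).restrict (Icc 0 1)) := by
    have h1 : MemLp (fun x => (g x, lam • v x)) 2 ((volume : Measure ℝ).restrict (Icc 0 1)) :=
      memLp_Icc_of_continuousOn (hgc.prodMk (hvc.const_smul lam)).continuousOn
    have h2 := (ContinuousLinearMap.inr ℂ (Fin m → ℂ) (Fin r ⊕ Fin m → ℂ)).comp_memLp' (Lp.memLp F)
    refine (h1.sub h2).ae_eq (Filter.Eventually.of_forall fun x => ?_)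
    simp
  have hwL : MemLp (fun x => recover T (g x, lam • v x - F x)) 2
      ((volume : Measure ℝ).restrict (Icc 0 1)) := (recover T).comp_memLp' hpL
  set V : L2 r m := hvL.toLp v with hV
  set w : L2 r m := hwL.toLp _ with hw
  have hVv : ∀ᵐ x ∂((volume : Measure ℝ).restrict (Icc 0 1)), V x = v x := hvL.coeFn_toLp
  have hww : ∀ᵐ x ∂((volume : Measure ℝ).restrict (Icc 0 1)),
      w x = recover T (g x, lam • v x - F x) := hwL.coeFn_toLp
  have hsub : ∀ x ∈ Icc (0 : ℝ) 1,
      ∫ y in (0 : ℝ)..x, (lam • v y - F y) = lam • (Y x).2 - Φ x := fun x hx => by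
    rw [intervalIntegral.integral_sub (f := fun y => lam • v y)
      ((hvc.const_smul lam).intervalIntegrable _ _)
      (intervalIntegrable_of_mem F.integrableOn hx), intervalIntegral.integral_smul, hY2i,
      hΦF x hx]
  refine ⟨V, ⟨v, w, glue ℂ (0, c), hVv, fun x hx => ?_, ?_, ?_⟩, ?_⟩
  · have hpi : IntervalIntegrable (fun x => (g x, lam • v x - F x)) volume 0 x :=
      intervalIntegrable_of_mem (hpL.integrable (by norm_num)) hx
    have h1 : ∫ y in (0 : ℝ)..x, (g y, lam • v y - F y) = ((Y x).1, lam • (Y x).2 - Φ x) := by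
      refine Prod.ext ?_ ?_
      · rw [← hY1i]
        exact ((ContinuousLinearMap.fst ℝ (Fin m → ℂ)
          (Fin r ⊕ Fin m → ℂ)).intervalIntegral_comp_comm hpi).symm
      · rw [← hsub x hx]
        exact ((ContinuousLinearMap.snd ℝ (Fin m → ℂ)
          (Fin r ⊕ Fin m → ℂ)).intervalIntegral_comp_comm hpi).symm
    rw [intervalIntegral_congr_of_mem hww hx, hv]
    simp only
    rw [← h1]
    exact ((recover T).intervalIntegral_comp_comm hpi).symm
  · rw [← hY1]
    exact (hT _).2
  · filter_upwards [hww, ae_restrict_mem measurableSet_Icc] with x h1 hx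
    have h2 : ∫ y in (0 : ℝ)..x, (lam • V - F : L2 r m) y = lam • (Y x).2 - Φ x := by
      rw [← hsub x hx]
      refine intervalIntegral_congr_of_mem ?_ hx
      filter_upwards [hVv, Lp.coeFn_sub (lam • V) F, Lp.coeFn_smul lam V] with y e1 e2 e3
      rw [e2, Pi.sub_apply, e3, Pi.smul_apply, e1]
    have h3 : projII ℂ (w x) = g x := by rw [h1]; exact (hT _).2
    have h4 : projI ℂ (toC A *ᵥ v x) = -projI ℂ (lam • (Y x).2 - Φ x) := (hT _).1
    rw [h2, h3, hg]
    simp only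
    rw [hR, ← glue_proj ℂ (glue ℂ (0, _) - toC A *ᵥ v x),
      ← glue_proj ℂ (glue ℂ (0, c) + (lam • (Y x).2 - Φ x))]
    congr 1
    refine Prod.ext ?_ ?_
    · change projI ℂ (_ - _) = projI ℂ (_ + _)
      rw [map_sub, map_add, h4, projI_glue, projI_glue]
      abel
    · change projII ℂ (_ - _) = projII ℂ (_ + _)
      simp only [map_sub, map_add, projII_glue]
      abel
  · have hb : ∀ x ∈ Icc (0 : ℝ) 1, ‖v x‖ ≤ ‖recover T‖ * (K + (‖lam‖ * K + 1)) * ‖F‖ := by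
      intro x hx
      rw [mul_assoc]
      refine ((recover T).le_opNorm _).trans (mul_le_mul_of_nonneg_left ?_ (norm_nonneg _))
      have e1 : ‖(Y x).1‖ ≤ K * ‖F‖ := (norm_fst_le _).trans (hYb x hx)
      have e2 : ‖(Y x).2‖ ≤ K * ‖F‖ := (norm_snd_le _).trans (hYb x hx)
      have e3 : ‖lam • (Y x).2 - Φ x‖ ≤ ‖lam‖ * (K * ‖F‖) + ‖F‖ :=
        (norm_sub_le _ _).trans (add_le_add (by
          rw [norm_smul]; exact mul_le_mul_of_nonneg_left e2 (norm_nonneg _)) (hΦb x hx))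
      refine (max_le_add_of_nonneg (norm_nonneg _) (norm_nonneg _)).trans
        ((add_le_add e1 e3).trans (le_of_eq ?_))
      ring
    refine (Lp.norm_le_of_ae_bound (C := ‖recover T‖ * (K + (‖lam‖ * K + 1)) * ‖F‖)
      (by positivity) ?_).trans (le_of_eq ?_)
    · filter_upwards [hVv, ae_restrict_mem measurableSet_Icc] with x h1 hx
      rw [h1]; exact hb x hx
    · simp [measureUnivNNReal]

end Resolvent

lemma isSpectrallyStable_of_const {f : StateVec r m → StateVec r m}
    {B₂₂ : StateVec r m → Matrix (Fin m) (Fin m) ℝ} (h2 : H2 f) (h3 : H3 f B₂₂)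
    {U₀ : StateVec r m} {U : ℝ → StateVec r m} (hU : ∀ x ∈ Icc (0 : ℝ) 1, U x = U₀) :
    IsSpectrallyStable f B₂₂ U := by
  obtain ⟨S₁₁, S₂₂, -, -, hS⟩ := h3
  obtain ⟨hpos, hsymm, hB⟩ := hS U₀
  have hpair : SymmetrizedPair (jac f U₀) (B₂₂ U₀) (S₁₁ U₀) (S₂₂ U₀) :=
    { symm := by simpa [Matrix.IsHermitian, Matrix.IsSymm] using hpos.isHermitian
      pos := fun x hx => dotProduct_mulVec_pos_of_posDef hpos hx
      symm_mul := hsymm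
      hyperbolic_pos := fun x hx =>
        dotProduct_mulVec_pos_of_posDef (posDef_block_mul hpos hsymm (h2 U₀)) hx
      viscous_pos := fun x hx => dotProduct_mulVec_pos_of_add_transpose hB hx }
  intro lam hlam
  obtain ⟨K, hK⟩ := hpair.exists_constantGraph (r := r) hlam
  obtain ⟨R, hR⟩ := exists_clm_of_relation
    (P := fun F V : L2 r m => ConstantGraph (jac f U₀) (B₂₂ U₀) V (lam • V - F))
    (fun a F V F' V' h h' => by
      convert h.smul_add a h' using 1
      module) hK
    (fun V hV => hpair.constantGraph_eq_zero hlam (by simpa using hV))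
  exact ⟨R, fun F V => (hR F V).trans (linearizedGraph_iff_of_const hU V _).symm⟩

end ViscousLaw

theorem theorem9p5 {r m : ℕ} (f : StateVec r m → StateVec r m)
    (B₂₂ : StateVec r m → Matrix (Fin m) (Fin m) ℝ)
    (h0 : ViscousLaw.H0 f B₂₂) (h1 : ViscousLaw.H1 B₂₂) (h2 : ViscousLaw.H2 f)
    (h3 : ViscousLaw.H3 f B₂₂) (hent : ViscousLaw.HasConvexEntropy f B₂₂)
    (U₀ : StateVec r m) (U₁ : Fin m → ℝ) (hdata : ViscousLaw.partII U₀ = U₁) :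
    (∀ U : ℝ → StateVec r m, ViscousLaw.IsSteadySolution f B₂₂ U₀ U₁ U ↔
      ∀ x ∈ Set.Icc (0 : ℝ) 1, U x = U₀) ∧
    (∀ U : ℝ → StateVec r m, ViscousLaw.IsSteadySolution f B₂₂ U₀ U₁ U →
      ViscousLaw.IsNondegenerate f B₂₂ U₀ U₁ U ∧ ViscousLaw.IsSpectrallyStable f B₂₂ U) := by
  refine ⟨fun U => ⟨fun hU => hU.eq_const h0 h1 h2 hent hdata,
    fun hU => ViscousLaw.isSteadySolution_of_const hdata hU⟩, fun U hU => ?_⟩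
  have hc := hU.eq_const h0 h1 h2 hent hdata
  exact ⟨ViscousLaw.isNondegenerate_of_const h0 h1 h2 h3
    (ViscousLaw.mixedMap_injective h0 h1 h2 hent) hdata hc,
    ViscousLaw.isSpectrallyStable_of_const h2 h3 hc⟩
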